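/- Let $n\ge 0$ and let $p(z)=a_0z^n+a_1z^{n-1}+\cdots+a_n$ and $q(z)=b_0z^n+b_1z^{n-1}+\cdots+b_n$ be polynomials with real coefficients, where $a_0>0$ (so $\deg p=n$ and $\deg q\le n$; the polynomial $q$ may be identically zero). Put $a_k=b_k=0$ for $k>n$, and define the infinite matrix of Hurwitz type $H(p,q)$ by $$ H(p,q)=\begin{pmatrix} a_0&a_1&a_2&a_3&\dots\\ 0&b_1&b_2&b_3&\dots\\ 0&a_0&a_1&a_2&\dots\\ 0&0&b_1&b_2&\dots\\ \vdots&\vdots&\vdots&\vdots&\ddots \end{pmatrix}\ \text{ if } b_0=0, \qquad H(p,q)=\begin{pmatrix} b_0&b_1&b_2&b_3&\dots\\ 0&a_0&a_1&a_2&\dots\\ 0&b_0&b_1&b_2&\dots\\ 0&0&a_0&a_1&\dots\\ \vdots&\vdots&\vdots&\vdots&\ddots \end{pmatrix}\ \text{ if } b_0\neq0. $$ A rational function $R$ is called an $R$-function of negative type if $\operatorname{Im}z>0$ implies $\operatorname{Im}R(z)<0$. An infinite matrix is called totally nonnegative if all its (finite) minors are nonnegative. Theorem (Total Nonnegativity of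 the Hurwitz Matrix). The following two conditions are equivalent: 1) All complex zeros of $p$ are real and nonpositive; either $q\equiv0$ or all complex zeros of $q$ are real and nonpositive; $b_0\ge 0$; and the rational function $R=q/p$ is either an $R$-function of negative type or constant (the case $R\equiv0$ included). 2) The infinite matrix of Hurwitz type $H(p,q)$ is totally nonnegative. -/

import Mathlib

open Polynomial

noncomputable section

/-- All complex zeros of the real polynomial `f` are real and nonpositive. -/
def HasOnlyNonposZeros (f : ℝ[X]) : Prop :=
  ∀ z : ℂ, aeval z f = 0 → z.im = 0 ∧ z.re ≤ 0

/-- The real rational function `R` is an `R`-function of negative type: it maps the open upper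
half-plane into the open lower half-plane. The value `R(z)` is computed from the reduced fraction;
at a pole `RatFunc.eval` returns `0`, which is not in the open lower half-plane, so the condition
forces `R` to have no poles in the upper half-plane. -/
def IsRFunctionNegType (R : RatFunc ℝ) : Prop :=
  ∀ z : ℂ, 0 < z.im → (R.eval (algebraMap ℝ ℂ) z).im < 0

/-- The rational function `q / p`. -/
def ratio (q p : ℝ[X]) : RatFunc ℝ :=
  algebraMap ℝ[X] (RatFunc ℝ) q / algebraMap ℝ[X] (RatFunc ℝ) p

/-- The coefficient `c k` in `f(z) = c 0 * z ^ n + c 1 * z ^ (n - 1) + ⋯ + c n`, where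
`c k = 0` for `k < 0` and for `k > n`. -/
def descCoeff (n : ℕ) (f : ℝ[X]) (k : ℤ) : ℝ :=
  if 0 ≤ k ∧ k ≤ n then f.coeff (n - k.toNat) else 0

/-- The infinite matrix of Hurwitz type `H(p, q)`, rows and columns indexed from `0`.
With `n = deg p`, `p = a 0 * z ^ n + ⋯ + a n` and `q = b 0 * z ^ n + ⋯ + b n`:
if `deg q < deg p`, rows `2 i` and `2 i + 1` have `j`-th entries `a (j - i)` and `b (j - i)`;
otherwise rows `2 i` and `2 i + 1` have `j`-th entries `b (j - i)` and `a (j - i - 1)`. -/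
def hurwitzMatrix (p q : ℝ[X]) : Matrix ℕ ℕ ℝ := fun s j =>
  let n := p.natDegree
  let i : ℕ := s / 2
  if q.degree < p.degree then
    if Even s then descCoeff n p ((j : ℤ) - i) else descCoeff n q ((j : ℤ) - i)
  else
    if Even s then descCoeff n q ((j : ℤ) - i) else descCoeff n p ((j : ℤ) - i - 1)

/-- An infinite matrix is totally nonnegative if all its (finite) minors are nonnegative. -/
def IsTotallyNonneg (A : Matrix ℕ ℕ ℝ) : Prop :=
  ∀ (k : ℕ) (r c : Fin k → ℕ), StrictMono r → StrictMono c → 0 ≤ (A.submatrix r c).det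

end

/-! Let f and g be the reversals of q and p (with respect to n). Up to removal of a first row and
column, H(p,q) is `interlaced f (X * g)`. A division step f = c g + x k with c = f(0)/g(0) factors
this matrix as a bidiagonal matrix with entries 0, 1, c times `interlaced g (X * k)`. Both
directions run this Euclidean algorithm, a continued fraction of f/g.

From 1) to 2): the poles of an R-function of negative type are simple with positive residues, so q/p
= c + Σ α_t/(z - t) with α_t ≥ 0, t ≤ 0, c ≥ 0. Hence two Bezoutian kernels of (f, g) are positive
semidefinite. A division step preserves this: one kernel is kept, the other passes to a Schur
complement. So every quotient c is nonnegative, and the algorithm stops at a common divisor with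
nonpositive zeros, whose Toeplitz matrix is a product of nonnegative bidiagonal ones
(`isTotallyNonneg_interlaced_of_bezoutian`).

From 2) to 1): the zeros are real by the Aissen–Schoenberg–Whitney theorem. A nonreal zero yields a
real zero-free sequence annihilated by a banded Toeplitz matrix; total nonnegativity allows it fewer
than n steps without sign change, whereas a recurrence with nonreal characteristic roots has
infinitely many. For the sign of Im(q/p), the Euclidean algorithm is run on the matrix. Inverting a
bidiagonal factor introduces negative entries, but minors on consecutive rows remain nonnegative,
which is enough (`im_pos_of_hasNonnegConsecutiveMinors`). -/

noncomputable section

/-! ### Toeplitz and Hurwitz matrices of polynomials -/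

/-- The upper triangular Toeplitz matrix of the coefficients of `f`. -/
def toeplitz (f : ℝ[X]) : Matrix ℕ ℕ ℝ := fun i j => if i ≤ j then f.coeff (j - i) else 0

/-- The matrix whose even rows are those of `toeplitz f` and whose odd rows are those of
`toeplitz g`. -/
def interlaced (f g : ℝ[X]) : Matrix ℕ ℕ ℝ := fun s j =>
  if Even s then toeplitz f (s / 2) j else toeplitz g (s / 2) j

lemma toeplitz_of_lt (f : ℝ[X]) {i j : ℕ} (h : j < i) : toeplitz f i j = 0 :=
  if_neg h.not_ge

lemma toeplitz_add (f : ℝ[X]) (i j : ℕ) : toeplitz f i (i + j) = f.coeff j := by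
  simp [toeplitz]

lemma toeplitz_succ_succ (f : ℝ[X]) (i j : ℕ) : toeplitz f (i + 1) (j + 1) = toeplitz f i j := by
  simp [toeplitz]

lemma toeplitz_X_mul (f : ℝ[X]) (i j : ℕ) : toeplitz (X * f) i j = toeplitz f (i + 1) j := by
  rcases lt_or_ge j i with h | h
  · rw [toeplitz_of_lt _ h, toeplitz_of_lt _ (by omega)]
  · obtain ⟨d, rfl⟩ := Nat.exists_eq_add_of_le h
    rcases d with _ | d
    · simp [toeplitz]
    · rw [toeplitz_add, coeff_X_mul, show i + (d + 1) = i + 1 + d by ring, toeplitz_add]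

lemma toeplitz_add_poly (f g : ℝ[X]) (i j : ℕ) :
    toeplitz (f + g) i j = toeplitz f i j + toeplitz g i j := by
  simp only [toeplitz]; split_ifs <;> simp

lemma toeplitz_C_mul (c : ℝ) (f : ℝ[X]) (i j : ℕ) :
    toeplitz (C c * f) i j = c * toeplitz f i j := by
  simp only [toeplitz]; split_ifs <;> simp

lemma interlaced_even (f g : ℝ[X]) (i j : ℕ) : interlaced f g (2 * i) j = toeplitz f i j := by
  simp [interlaced]

lemma interlaced_odd (f g : ℝ[X]) (i j : ℕ) :
    interlaced f g (2 * i + 1) j = toeplitz g i j := by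
  have h : (2 * i + 1) / 2 = i := by omega
  simp [interlaced, h]

lemma interlaced_shift (f g : ℝ[X]) (s j : ℕ) :
    interlaced f g (s + 2) (j + 1) = interlaced f g s j := by
  obtain ⟨i, rfl | rfl⟩ := s.even_or_odd'
  · rw [show 2 * i + 2 = 2 * (i + 1) by ring, interlaced_even, interlaced_even, toeplitz_succ_succ]
  · rw [show 2 * i + 1 + 2 = 2 * (i + 1) + 1 by ring, interlaced_odd, interlaced_odd,
      toeplitz_succ_succ]

/-! ### Operations preserving total nonnegativity -/

lemma IsTotallyNonneg.det_nonneg_of_monotone {A : Matrix ℕ ℕ ℝ} (hA : IsTotallyNonneg A) {k : ℕ}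
    {r c : Fin k → ℕ} (hr : Monotone r) (hc : StrictMono c) : 0 ≤ (A.submatrix r c).det := by
  by_cases h : Function.Injective r
  · exact hA k r c (hr.strictMono_of_injective h) hc
  · obtain ⟨i, j, hij, hne⟩ : ∃ i j, r i = r j ∧ i ≠ j := by
      simpa [Function.Injective] using h
    rw [Matrix.det_zero_of_row_eq hne]
    ext l
    simp [hij]

lemma IsTotallyNonneg.entry_nonneg {A : Matrix ℕ ℕ ℝ} (hA : IsTotallyNonneg A) (i j : ℕ) :
    0 ≤ A i j := by
  simpa using hA 1 (fun _ => i) (fun _ => j) (Subsingleton.strictMono _)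
    (Subsingleton.strictMono _)

lemma IsTotallyNonneg.submatrix {A : Matrix ℕ ℕ ℝ} (hA : IsTotallyNonneg A) {u v : ℕ → ℕ}
    (hu : StrictMono u) (hv : StrictMono v) : IsTotallyNonneg (A.submatrix u v) :=
  fun k r c hr hc => hA k (u ∘ r) (v ∘ c) (hu.comp hr) (hv.comp hc)

/-- Multiplication from the left by a nonnegative upper bidiagonal matrix. -/
lemma IsTotallyNonneg.bidiagonal_mul {A B : Matrix ℕ ℕ ℝ} (hA : IsTotallyNonneg A) {α β : ℕ → ℝ}
    (hα : ∀ s, 0 ≤ α s) (hβ : ∀ s, 0 ≤ β s)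
    (hB : ∀ s j, B s j = α s * A s j + β s * A (s + 1) j) : IsTotallyNonneg B := by
  obtain rfl : B = fun s j => α s * A s j + β s * A (s + 1) j := funext₂ hB
  intro k r c hr hc
  have h := (Matrix.detRowAlternating (n := Fin k) (R := ℝ)).toMultilinearMap.map_add_univ
    (fun i j => α (r i) * A (r i) (c j)) (fun i j => β (r i) * A (r i + 1) (c j))
  change Matrix.det _ = _ at h
  refine le_of_le_of_eq ?_ h.symm
  -- Each term takes from row `r i` either `A (r i)` or `A (r i + 1)`. The chosen indices stay
  -- weakly increasing, so the term is a nonnegative multiple of a minor, possibly with repeated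
  -- rows.
  refine Finset.sum_nonneg fun s _ => ?_
  let w : Fin k → ℝ := fun i => if i ∈ s then α (r i) else β (r i)
  let e : Fin k → ℕ := fun i => if i ∈ s then r i else r i + 1
  have he : Monotone e := by
    intro i j hij
    rcases hij.eq_or_lt with rfl | hlt
    · rfl
    · have := hr hlt
      simp only [e]; split_ifs <;> omega
  have hw : 0 ≤ (∏ i, w i) * (A.submatrix e c).det := by
    refine mul_nonneg (Finset.prod_nonneg fun i _ => ?_) (hA.det_nonneg_of_monotone he hc)
    simp only [w]; split_ifs
    exacts [hα _, hβ _]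
  rw [← Matrix.det_mul_column] at hw
  refine le_of_le_of_eq hw (congrArg Matrix.det ?_)
  ext i j
  by_cases hi : i ∈ s <;> simp [w, e, hi, Finset.piecewise]

lemma isTotallyNonneg_one : IsTotallyNonneg (1 : Matrix ℕ ℕ ℝ) := by
  intro k r c hr hc
  by_cases h : r = c
  · subst h
    rw [Matrix.submatrix_one _ hr.injective, Matrix.det_one]; exact zero_le_one
  · obtain ⟨i, hi⟩ : ∃ i, ∀ j, r i ≠ c j := by
      by_contra! hcon
      refine h ((hr.range_inj hc).1 ?_)
      choose σ hσ using hcon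
      have hσ' : Function.Injective σ := fun a b hab => hr.injective (by rw [hσ a, hσ b, hab])
      ext x
      constructor
      · rintro ⟨a, rfl⟩; exact ⟨σ a, (hσ a).symm⟩
      · rintro ⟨a, rfl⟩
        obtain ⟨b, rfl⟩ := (Finite.injective_iff_surjective.1 hσ') a
        exact ⟨b, hσ b⟩
    rw [Matrix.det_eq_zero_of_row_eq_zero i fun j => by simp [hi j]]

lemma toeplitz_one : toeplitz 1 = 1 := by
  ext i j
  rcases lt_trichotomy i j with h | rfl | h
  · rw [toeplitz, if_pos h.le, Matrix.one_apply_ne h.ne, coeff_one, if_neg (by omega)]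
  · simp [toeplitz]
  · rw [toeplitz_of_lt _ h, Matrix.one_apply_ne h.ne']

lemma IsTotallyNonneg.toeplitz_X_add_C_mul {f : ℝ[X]} (hf : IsTotallyNonneg (toeplitz f)) {ω : ℝ}
    (hω : 0 ≤ ω) : IsTotallyNonneg (toeplitz ((X + C ω) * f)) := by
  refine hf.bidiagonal_mul (α := fun _ => ω) (β := fun _ => 1) (fun _ => hω)
    (fun _ => zero_le_one) fun i j => ?_
  rw [add_mul, toeplitz_add_poly, toeplitz_X_mul, toeplitz_C_mul]; ring

lemma IsTotallyNonneg.toeplitz_C_mul {f : ℝ[X]} (hf : IsTotallyNonneg (toeplitz f)) {c : ℝ}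
    (hc : 0 ≤ c) : IsTotallyNonneg (toeplitz (C c * f)) := by
  refine hf.bidiagonal_mul (α := fun _ => c) (β := fun _ => 0) (fun _ => hc)
    (fun _ => le_rfl) fun i j => ?_
  rw [_root_.toeplitz_C_mul]; ring

lemma isTotallyNonneg_toeplitz_of_splits {f : ℝ[X]} (hf : f.Splits) (hlc : 0 ≤ f.leadingCoeff)
    (hroots : ∀ x ∈ f.roots, x ≤ 0) : IsTotallyNonneg (toeplitz f) := by
  rw [hf.eq_prod_roots]
  refine IsTotallyNonneg.toeplitz_C_mul ?_ hlc
  generalize f.roots = S at hroots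
  induction S using Multiset.induction_on with
  | empty => simpa [toeplitz_one] using isTotallyNonneg_one
  | cons a S ih =>
    rw [Multiset.map_cons, Multiset.prod_cons]
    have h := (ih fun x hx => hroots x (Multiset.mem_cons_of_mem hx)).toeplitz_X_add_C_mul
      (neg_nonneg.2 (hroots a (Multiset.mem_cons_self _ _)))
    simpa [sub_eq_add_neg] using h

lemma isTotallyNonneg_interlaced_zero {f : ℝ[X]} (hf : IsTotallyNonneg (toeplitz f)) :
    IsTotallyNonneg (interlaced f 0) := by
  intro k r c hr hc
  by_cases h : ∀ i, Even (r i)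
  · have hr' : StrictMono fun i => r i / 2 := by
      intro i j hij
      have h1 := hr hij
      obtain ⟨a, ha⟩ := h i
      obtain ⟨b, hb⟩ := h j
      simp only; omega
    convert hf k (fun i => r i / 2) c hr' hc using 2
    ext i j
    simp [interlaced, h i]
  · push Not at h
    obtain ⟨i, hi⟩ := h
    rw [Matrix.det_eq_zero_of_row_eq_zero i fun j => by
      simp only [Matrix.submatrix_apply, interlaced, if_neg hi, toeplitz]; simp]

lemma eq_C_mul_add_X_mul_divX {f g : ℝ[X]} (hg : g.coeff 0 ≠ 0) :
    f = C (f.coeff 0 / g.coeff 0) * g + X * (f - C (f.coeff 0 / g.coeff 0) * g).divX := by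
  have h := divX_mul_X_add (f - C (f.coeff 0 / g.coeff 0) * g)
  have h0 : (f - C (f.coeff 0 / g.coeff 0) * g).coeff 0 = 0 := by
    simp [div_mul_cancel₀ _ hg]
  rw [h0, C_0, add_zero, mul_comm] at h
  rw [h]; ring

/-- The division step as a bidiagonal factor: the new row 2i is c times the old row 2i plus the old
row 2i+1, and the new row 2i+1 is the old row 2i+2. -/
lemma IsTotallyNonneg.interlaced_step {c : ℝ} (hc : 0 ≤ c) {g k : ℝ[X]}
    (h : IsTotallyNonneg (interlaced g (X * k))) :
    IsTotallyNonneg (interlaced (C c * g + X * k) (X * g)) := by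
  refine h.bidiagonal_mul (α := fun s => if Even s then c else 0) (β := fun _ => 1)
    (fun s => by split_ifs <;> simp [hc]) (fun _ => zero_le_one) fun s j => ?_
  obtain ⟨i, rfl | rfl⟩ := s.even_or_odd'
  · rw [interlaced_even, interlaced_even, interlaced_odd, toeplitz_add_poly,
      _root_.toeplitz_C_mul]
    simp
  · rw [interlaced_odd, show 2 * i + 1 + 1 = 2 * (i + 1) by ring, interlaced_even,
      toeplitz_X_mul]
    simp

/-! ### Positive semidefinite Bezoutian kernels -/

/-- A symmetric positive semidefinite kernel on `ℕ`. -/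
structure IsPSDKernel (K : ℕ → ℕ → ℝ) : Prop where
  symm : ∀ i j, K i j = K j i
  nonneg : ∀ (N : ℕ) (v : ℕ → ℝ),
    0 ≤ ∑ i ∈ Finset.range N, ∑ j ∈ Finset.range N, v i * v j * K i j

namespace IsPSDKernel

lemma mul_self {a : ℕ → ℝ} {c : ℝ} (hc : 0 ≤ c) : IsPSDKernel fun i j => c * (a i * a j) := by
  refine ⟨fun i j => by ring, fun N v => ?_⟩
  have h : ∑ i ∈ Finset.range N, ∑ j ∈ Finset.range N, v i * v j * (c * (a i * a j)) =
      c * ((∑ i ∈ Finset.range N, v i * a i) * ∑ j ∈ Finset.range N, v j * a j) := by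
    rw [Finset.sum_mul_sum]
    simp only [Finset.mul_sum]
    exact Finset.sum_congr rfl fun i _ => Finset.sum_congr rfl fun j _ => by ring
  rw [h]
  exact mul_nonneg hc (mul_self_nonneg _)

lemma add {K L : ℕ → ℕ → ℝ} (hK : IsPSDKernel K) (hL : IsPSDKernel L) :
    IsPSDKernel fun i j => K i j + L i j := by
  refine ⟨fun i j => by simp only [hK.symm i j, hL.symm i j], fun N v => ?_⟩
  simp only [mul_add, Finset.sum_add_distrib]
  exact add_nonneg (hK.nonneg N v) (hL.nonneg N v)

lemma sum {ι : Type*} {s : Finset ι} {K : ι → ℕ → ℕ → ℝ} (h : ∀ t ∈ s, IsPSDKernel (K t)) :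
    IsPSDKernel fun i j => ∑ t ∈ s, K t i j := by
  classical
  induction s using Finset.induction_on with
  | empty => exact ⟨by simp, by simp⟩
  | insert a s ha ih =>
    simp only [Finset.sum_insert ha]
    exact (h a (Finset.mem_insert_self _ _)).add
      (ih fun t ht => h t (Finset.mem_insert_of_mem ht))

lemma apply_zero_zero_nonneg {K : ℕ → ℕ → ℝ} (hK : IsPSDKernel K) : 0 ≤ K 0 0 := by
  simpa using hK.nonneg 1 1

/-- The value of the quadratic form, with the coordinate `0` split off. -/
lemma nonneg_cons {K : ℕ → ℕ → ℝ} (hK : IsPSDKernel K) (N : ℕ) (t : ℝ) (v : ℕ → ℝ) :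
    0 ≤ ∑ i ∈ Finset.range N, ∑ j ∈ Finset.range N, v i * v j * K (i + 1) (j + 1) +
      2 * t * ∑ i ∈ Finset.range N, v i * K (i + 1) 0 + t ^ 2 * K 0 0 := by
  have h := hK.nonneg (N + 1) (fun i => if i = 0 then t else v (i - 1))
  simp only [Finset.sum_range_succ', Finset.sum_add_distrib] at h
  simp only [Nat.add_eq_zero_iff, one_ne_zero, and_false, if_false, Nat.add_sub_cancel,
    if_true] at h
  refine h.trans_eq ?_
  have h1 : ∑ i ∈ Finset.range N, v i * t * K (i + 1) 0 =
      t * ∑ i ∈ Finset.range N, v i * K (i + 1) 0 := by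
    rw [Finset.mul_sum]; exact Finset.sum_congr rfl fun i _ => by ring
  have h2 : ∑ i ∈ Finset.range N, t * v i * K 0 (i + 1) =
      t * ∑ i ∈ Finset.range N, v i * K (i + 1) 0 := by
    rw [Finset.mul_sum]; exact Finset.sum_congr rfl fun i _ => by rw [hK.symm 0]; ring
  rw [h1, h2]; ring

/-- If the first diagonal entry vanishes, so does the first column. -/
lemma apply_zero_eq_zero {K : ℕ → ℕ → ℝ} (hK : IsPSDKernel K) (h0 : K 0 0 = 0) (i : ℕ) :
    K i 0 = 0 := by
  rcases i with _ | i
  · exact h0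
  by_contra hne
  -- With this `t` in coordinate 0 and 1 in coordinate i+1, the quadratic form would equal -1.
  obtain ⟨t, ht⟩ : ∃ t, 2 * t * K (i + 1) 0 = -(K (i + 1) (i + 1) + 1) :=
    ⟨-(K (i + 1) (i + 1) + 1) / (2 * K (i + 1) 0), by field_simp⟩
  have h := hK.nonneg_cons (i + 1) t (fun j => if j = i then 1 else 0)
  simp only [h0, ite_mul, one_mul, zero_mul, Finset.sum_ite_eq', Finset.mem_range,
    Nat.lt_succ_self, if_true, mul_zero, add_zero, mul_ite, ht] at h
  simp at h
  linarith

/-- The Schur complement of the first diagonal entry. -/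
lemma schur_complement {K : ℕ → ℕ → ℝ} (hK : IsPSDKernel K) {a : ℕ → ℝ} {c : ℝ} (ha : a 0 ≠ 0)
    (h : ∀ i, K i 0 = c * (a i * a 0)) :
    IsPSDKernel fun i j => K (i + 1) (j + 1) - c * (a (i + 1) * a (j + 1)) := by
  refine ⟨fun i j => by rw [hK.symm]; ring, fun N v => ?_⟩
  set S := ∑ i ∈ Finset.range N, v i * a (i + 1) with hS
  -- Coordinate 0 enters the form through c (S + t a₀)² - c S²; this `t` kills the square.
  have h1 := hK.nonneg_cons N (-S / a 0) v
  have h2 : ∑ i ∈ Finset.range N, v i * K (i + 1) 0 = c * a 0 * S := by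
    rw [hS, Finset.mul_sum]
    exact Finset.sum_congr rfl fun i _ => by rw [h]; ring
  have h3 : ∑ i ∈ Finset.range N, ∑ j ∈ Finset.range N,
      v i * v j * (c * (a (i + 1) * a (j + 1))) = c * (S * S) := by
    rw [hS, Finset.sum_mul_sum]
    simp only [Finset.mul_sum]
    exact Finset.sum_congr rfl fun i _ => Finset.sum_congr rfl fun j _ => by ring
  simp only [mul_sub, Finset.sum_sub_distrib, h3]
  rw [h2, h] at h1
  refine h1.trans_eq ?_
  field_simp
  ring

end IsPSDKernel

/-- The kernel `(f(x) g(y) - f(y) g(x)) / (x - y)` is positive semidefinite: its coefficients `K`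
are described by recursion along the antidiagonals. -/
def HasPSDBezoutian (f g : ℝ[X]) : Prop :=
  ∃ K : ℕ → ℕ → ℝ, IsPSDKernel K ∧
    (∀ i, K i 0 = f.coeff (i + 1) * g.coeff 0 - f.coeff 0 * g.coeff (i + 1)) ∧
    ∀ i j, K i (j + 1) - K (i + 1) j =
      f.coeff (i + 1) * g.coeff (j + 1) - f.coeff (j + 1) * g.coeff (i + 1)

/-- The kernel `(x f(y) g(x) - y f(x) g(y)) / (x - y)` is positive semidefinite. -/
def HasPSDShiftedBezoutian (f g : ℝ[X]) : Prop :=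
  ∃ K : ℕ → ℕ → ℝ, IsPSDKernel K ∧ (∀ i, K i 0 = g.coeff i * f.coeff 0) ∧
    ∀ i j, K i (j + 1) - K (i + 1) j =
      g.coeff i * f.coeff (j + 1) - f.coeff (i + 1) * g.coeff j

/-- The same kernel serves: the terms c g(x) g(y) cancel in f(x)g(y) - f(y)g(x), leaving x k(x) g(y)
- y k(y) g(x). -/
lemma HasPSDBezoutian.shifted {c : ℝ} {g k : ℝ[X]} (h : HasPSDBezoutian (C c * g + X * k) g) :
    HasPSDShiftedBezoutian g k := by
  obtain ⟨K, hK, h0, h1⟩ := h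
  refine ⟨K, hK, fun i => ?_, fun i j => ?_⟩
  · rw [h0]; simp; ring
  · rw [h1]; simp; ring

/-- Here the shifted kernel of (f, g) equals c g(x)g(y) + xy·Bez(g, k), so Bez(g, k) is the Schur
complement of its corner entry. -/
lemma HasPSDShiftedBezoutian.bezoutian {c : ℝ} {g k : ℝ[X]} (hg : g.coeff 0 ≠ 0)
    (h : HasPSDShiftedBezoutian (C c * g + X * k) g) : HasPSDBezoutian g k := by
  obtain ⟨K, hK, h0, h1⟩ := h
  refine ⟨_, hK.schur_complement (c := c) (a := g.coeff) hg fun i => ?_, fun i => ?_,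
    fun i j => ?_⟩
  · rw [h0]; simp; ring
  · have h2 := h1 (i + 1) 0
    rw [h0] at h2
    simp at h2 ⊢
    linarith
  · have h2 := h1 (i + 1) (j + 1)
    simp at h2 ⊢
    linarith

lemma HasPSDShiftedBezoutian.mul_nonneg {f g : ℝ[X]} (h : HasPSDShiftedBezoutian f g) :
    0 ≤ g.coeff 0 * f.coeff 0 := by
  obtain ⟨K, hK, h0, -⟩ := h
  rw [← h0]; exact hK.apply_zero_zero_nonneg

/-- The first column of the kernel is g(0) times the coefficients of k, and it vanishes together
with its corner. This ends the Euclidean algorithm. -/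
lemma HasPSDShiftedBezoutian.eq_zero {g k : ℝ[X]} (h : HasPSDShiftedBezoutian g k)
    (hg : g.coeff 0 ≠ 0) (hk : k.coeff 0 = 0) : k = 0 := by
  obtain ⟨K, hK, h0, -⟩ := h
  ext i
  have h1 := hK.apply_zero_eq_zero (by rw [h0, hk, zero_mul]) i
  rw [h0] at h1
  simpa [hg] using h1

/-- Induction along the Euclidean algorithm. Weighing degrees as 2 deg f and 2 deg g + 1 makes the
bound `N` drop by one at every step, even when deg f = deg g. The hypothesis on divisors is
inherited and is used on the last remainder. -/
theorem isTotallyNonneg_interlaced_of_bezoutian (N : ℕ) : ∀ f g : ℝ[X],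
    (∀ i, N ≤ 2 * i → f.coeff i = 0) → (∀ i, N ≤ 2 * i + 1 → g.coeff i = 0) → 0 < g.coeff 0 →
    HasPSDBezoutian f g → HasPSDShiftedBezoutian f g →
    (∀ d : ℝ[X], d ∣ f → d ∣ g → 0 < d.coeff 0 → IsTotallyNonneg (toeplitz d)) →
    IsTotallyNonneg (interlaced f (X * g)) := by
  induction N with
  | zero =>
    intro f g _ hg hg0
    exact absurd (hg 0 (Nat.zero_le _)) hg0.ne'
  | succ N ih =>
    intro f g hf hg hg0 hB hS hd
    have hc : 0 ≤ f.coeff 0 / g.coeff 0 :=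
      div_nonneg (nonneg_of_mul_nonneg_right hS.mul_nonneg hg0) hg0.le
    have hfk := eq_C_mul_add_X_mul_divX (f := f) hg0.ne'
    generalize f.coeff 0 / g.coeff 0 = c at hc hfk
    generalize (f - C c * g).divX = k at hfk
    subst hfk
    refine IsTotallyNonneg.interlaced_step hc ?_
    have hgk := hB.shifted
    rcases hgk.mul_nonneg.eq_or_lt' with h0 | h0
    · have hk : k = 0 := hgk.eq_zero hg0.ne' (by simpa [hg0.ne'] using h0)
      subst hk
      rw [mul_zero]
      exact isTotallyNonneg_interlaced_zero (hd g ⟨C c, by ring⟩ dvd_rfl hg0)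
    · refine ih g k (fun i hi => hg i (by omega)) (fun i hi => ?_)
        (pos_of_mul_pos_left h0 hg0.le) (hS.bezoutian hg0.ne') hgk fun d hdg hdk hd0 => ?_
      · have h1 := hf (i + 1) (by omega)
        have h2 := hg (i + 1) (by omega)
        simpa [h2] using h1
      · exact hd d (dvd_add (hdg.mul_left _) (hdk.mul_left _)) hdg hd0

/-- Sums of simple fractions with nonnegative coefficients have positive semidefinite
Bezoutians. -/
lemma hasPSDBezoutian_of_partialFractions {ι : Type*} {s : Finset ι} {α ω : ι → ℝ} {u : ι → ℝ[X]}
    {a b : ℝ[X]} {c : ℝ} (hα : ∀ t ∈ s, 0 ≤ α t) (hu : ∀ t ∈ s, a = (1 + C (ω t) * X) * u t)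
    (hb : b = C c * a + ∑ t ∈ s, C (α t) * (X * u t)) : HasPSDBezoutian b a := by
  have ha0 : ∀ t ∈ s, a.coeff 0 = (u t).coeff 0 := fun t ht => by
    rw [hu t ht, add_mul, mul_assoc]; simp
  have ha1 : ∀ t ∈ s, ∀ i, a.coeff (i + 1) = (u t).coeff (i + 1) + ω t * (u t).coeff i :=
    fun t ht i => by rw [hu t ht, add_mul, mul_assoc]; simp
  have hb0 : b.coeff 0 = c * a.coeff 0 := by rw [hb]; simp
  have hb1 : ∀ i, b.coeff (i + 1) = c * a.coeff (i + 1) + ∑ t ∈ s, α t * (u t).coeff i :=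
    fun i => by rw [hb]; simp
  -- The kernel is Σ α_t u_t(x) u_t(y).
  refine ⟨_, IsPSDKernel.sum fun t ht => IsPSDKernel.mul_self (a := (u t).coeff) (hα t ht),
    fun i => ?_, fun i j => ?_⟩
  · have h : ∑ t ∈ s, α t * ((u t).coeff i * (u t).coeff 0) =
        (∑ t ∈ s, α t * (u t).coeff i) * a.coeff 0 := by
      rw [Finset.sum_mul]
      exact Finset.sum_congr rfl fun t ht => by rw [ha0 t ht]; ring
    rw [hb0, hb1, h]; ring
  · have h : ∑ t ∈ s, α t * ((u t).coeff i * (u t).coeff (j + 1)) -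
        ∑ t ∈ s, α t * ((u t).coeff (i + 1) * (u t).coeff j) =
        (∑ t ∈ s, α t * (u t).coeff i) * a.coeff (j + 1) -
          (∑ t ∈ s, α t * (u t).coeff j) * a.coeff (i + 1) := by
      rw [Finset.sum_mul, Finset.sum_mul, ← Finset.sum_sub_distrib, ← Finset.sum_sub_distrib]
      exact Finset.sum_congr rfl fun t ht => by rw [ha1 t ht, ha1 t ht]; ring
    rw [hb1, hb1, h]; ring

lemma hasPSDShiftedBezoutian_of_partialFractions {ι : Type*} {s : Finset ι} {α ω : ι → ℝ}
    {u : ι → ℝ[X]} {a b : ℝ[X]} {c : ℝ} (hα : ∀ t ∈ s, 0 ≤ α t) (hω : ∀ t ∈ s, 0 ≤ ω t)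
    (hc : 0 ≤ c) (hu : ∀ t ∈ s, a = (1 + C (ω t) * X) * u t)
    (hb : b = C c * a + ∑ t ∈ s, C (α t) * (X * u t)) : HasPSDShiftedBezoutian b a := by
  have ha : ∀ t ∈ s, ∀ i, a.coeff i = (u t).coeff i + ω t * (X * u t).coeff i :=
    fun t ht i => by rw [hu t ht, add_mul, mul_assoc]; simp
  have hb0 : b.coeff 0 = c * a.coeff 0 := by rw [hb]; simp
  have hb1 : ∀ i, b.coeff (i + 1) = c * a.coeff (i + 1) + ∑ t ∈ s, α t * (u t).coeff i :=
    fun i => by rw [hb]; simp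
  -- The kernel is c a(x)a(y) + Σ α_t ω_t (x u_t(x)) (y u_t(y)).
  refine ⟨_, (IsPSDKernel.mul_self (a := a.coeff) hc).add (IsPSDKernel.sum fun t ht =>
    IsPSDKernel.mul_self (a := (X * u t).coeff) (mul_nonneg (hα t ht) (hω t ht))),
    fun i => ?_, fun i j => ?_⟩
  · rw [hb0]; simp; ring
  · have h : ∑ t ∈ s, α t * ω t * ((X * u t).coeff i * (X * u t).coeff (j + 1)) -
        ∑ t ∈ s, α t * ω t * ((X * u t).coeff (i + 1) * (X * u t).coeff j) =
        a.coeff i * (∑ t ∈ s, α t * (u t).coeff j) -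
          (∑ t ∈ s, α t * (u t).coeff i) * a.coeff j := by
      rw [Finset.mul_sum, Finset.sum_mul, ← Finset.sum_sub_distrib, ← Finset.sum_sub_distrib]
      refine Finset.sum_congr rfl fun t ht => ?_
      rw [ha t ht i, ha t ht j, coeff_X_mul, coeff_X_mul]; ring
    rw [hb1, hb1]
    linear_combination h

/-! ### Partial fractions of `R`-functions of negative type -/

lemma splits_of_forall_im_eq_zero {f : ℝ[X]} (h : ∀ z : ℂ, aeval z f = 0 → z.im = 0) :
    f.Splits := by
  refine Splits.of_splits_map (algebraMap ℝ ℂ) (IsAlgClosed.splits _) fun z hz => ?_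
  have hz' : aeval z f = 0 := by
    have := (mem_roots'.1 hz).2
    rwa [IsRoot.def, eval_map_algebraMap] at this
  exact ⟨z.re, Complex.ext rfl (by simp [h z hz'])⟩

lemma aeval_ofReal (f : ℝ[X]) (t : ℝ) : aeval (t : ℂ) f = ((f.eval t : ℝ) : ℂ) := by
  have h := aeval_algebraMap_apply ℂ t f
  rwa [coe_aeval_eq_eval] at h

/-- The poles on the real line of a real rational function that maps the upper half-plane to the
lower half-plane are simple and have positive residues. -/
lemma simple_pole_of_im_neg {q p : ℝ[X]} {t : ℝ} {m : ℕ} (hm : m ≠ 0) (hq : q.eval t ≠ 0)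
    (hp : p.eval t ≠ 0)
    (h : ∀ z : ℂ, 0 < z.im → (aeval z q / aeval z ((X - C t) ^ m * p)).im < 0) :
    m = 1 ∧ 0 < q.eval t / p.eval t := by
  set β := q.eval t / p.eval t with hβ
  have hβ0 : β ≠ 0 := div_ne_zero hq hp
  -- Approach the pole along z = t + ε e^{iφ}: ε^m times the quotient tends to β e^{-imφ}, whose
  -- imaginary part cannot be positive.
  have key : ∀ φ : ℝ, 0 < φ → φ < Real.pi → 0 ≤ β * Real.sin (m * φ) := by
    intro φ h0 hπ
    set w : ℂ := Complex.exp (φ * Complex.I) with hw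
    have hwim : 0 < w.im := by
      rw [hw, Complex.exp_ofReal_mul_I_im]; exact Real.sin_pos_of_pos_of_lt_pi h0 hπ
    have hlim : Filter.Tendsto (fun ε : ℝ => (aeval ((t : ℂ) + ε * w) q /
        aeval ((t : ℂ) + ε * w) p / w ^ m).im) (nhdsWithin 0 (Set.Ioi 0))
        (nhds ((β : ℂ) / w ^ m).im) := by
      have hq' : ContinuousAt (fun ε : ℝ => aeval ((t : ℂ) + ε * w) q) 0 := by
        have : Continuous fun ε : ℝ => aeval ((t : ℂ) + ε * w) q :=
          q.continuous_aeval.comp (by fun_prop)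
        exact this.continuousAt
      have hp' : ContinuousAt (fun ε : ℝ => aeval ((t : ℂ) + ε * w) p) 0 := by
        have : Continuous fun ε : ℝ => aeval ((t : ℂ) + ε * w) p :=
          p.continuous_aeval.comp (by fun_prop)
        exact this.continuousAt
      have hc := Complex.continuous_im.continuousAt.comp
        ((hq'.div hp' (by simpa [aeval_ofReal] using hp)).div_const (w ^ m))
      have ht := hc.tendsto.mono_left (nhdsWithin_le_nhds (s := Set.Ioi 0))
      simpa [aeval_ofReal, hβ, Function.comp_def] using ht
    have hle : ((β : ℂ) / w ^ m).im ≤ 0 := by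
      refine le_of_tendsto hlim ?_
      filter_upwards [self_mem_nhdsWithin] with ε hε
      have hε' : (0 : ℝ) < ε := hε
      have h1 := h ((t : ℂ) + ε * w) (by simpa using mul_pos hε' hwim)
      have h2 : aeval ((t : ℂ) + ε * w) q / aeval ((t : ℂ) + ε * w) ((X - C t) ^ m * p) =
          ((ε ^ m)⁻¹ : ℝ) * (aeval ((t : ℂ) + ε * w) q / aeval ((t : ℂ) + ε * w) p / w ^ m) := by
        simp [mul_pow, div_eq_mul_inv]
        ring
      rw [h2, Complex.im_ofReal_mul] at h1
      exact (neg_of_mul_neg_right h1 (by positivity)).le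
    have hwm : (w ^ m)⁻¹ = Complex.exp ((-(m * φ) : ℝ) * Complex.I) := by
      rw [hw, ← Complex.exp_nat_mul, ← Complex.exp_neg]
      congr 1; push_cast; ring
    rw [div_eq_mul_inv, hwm, Complex.im_ofReal_mul, Complex.exp_ofReal_mul_I_im,
      Real.sin_neg] at hle
    linarith
  have hm0 : (0 : ℝ) < m := by exact_mod_cast Nat.pos_of_ne_zero hm
  have hm1 : (1 : ℝ) ≤ m := by exact_mod_cast Nat.one_le_iff_ne_zero.2 hm
  have hπ := Real.pi_pos
  have hβpos : 0 < β := by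
    have h1 := key (Real.pi / (2 * m)) (by positivity) (by
      rw [div_lt_iff₀ (by positivity)]; nlinarith)
    rw [show (m : ℝ) * (Real.pi / (2 * m)) = Real.pi / 2 by field_simp, Real.sin_pi_div_two,
      mul_one] at h1
    exact lt_of_le_of_ne h1 hβ0.symm
  refine ⟨?_, hβpos⟩
  by_contra hne
  have hm2 : (2 : ℝ) ≤ m := by
    have : 2 ≤ m := by omega
    exact_mod_cast this
  -- This angle is below π only because m ≥ 2, and the sine there is -1.
  have h1 := key (3 * Real.pi / (2 * m)) (by positivity) (by
    rw [div_lt_iff₀ (by positivity)]; nlinarith)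
  rw [show (m : ℝ) * (3 * Real.pi / (2 * m)) = Real.pi / 2 + Real.pi by field_simp; ring,
    Real.sin_add_pi, Real.sin_pi_div_two] at h1
  linarith

lemma exists_partialFractions_of_isCoprime {q p : ℝ[X]} (hp : p.Monic) (hdeg : q.degree ≤ p.degree)
    (hz : HasOnlyNonposZeros p) (hpq : IsCoprime q p)
    (h : ∀ z : ℂ, 0 < z.im → (aeval z q / aeval z p).im < 0) :
    ∃ (s : Finset ℝ) (α : ℝ → ℝ) (u : ℝ → ℝ[X]) (c : ℝ), (∀ t ∈ s, t ≤ 0) ∧ (∀ t ∈ s, 0 ≤ α t) ∧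
      (∀ t ∈ s, p = (X - C t) * u t) ∧ q = C c * p + ∑ t ∈ s, C (α t) * u t := by
  have hsplit : p.Splits := splits_of_forall_im_eq_zero fun z hz' => (hz z hz').1
  have hroot : ∀ t ∈ p.roots.toFinset, p.eval t = 0 := fun t ht =>
    (mem_roots'.1 (Multiset.mem_toFinset.1 ht)).2
  have hpole : ∀ t ∈ p.roots.toFinset, ∃ u : ℝ[X], p = (X - C t) * u ∧ u.eval t ≠ 0 ∧
      0 < q.eval t / u.eval t ∧ p.roots.count t = 1 := by
    intro t ht
    have hpt := hroot t ht
    have hqt : q.eval t ≠ 0 := by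
      intro hqt
      obtain ⟨a, b, hab⟩ := hpq
      simpa [hqt, hpt] using congrArg (eval t) hab
    obtain ⟨u, hu, hdvd⟩ := exists_eq_pow_rootMultiplicity_mul_and_not_dvd p hp.ne_zero t
    have hut : u.eval t ≠ 0 := fun h0 => hdvd (dvd_iff_isRoot.2 h0)
    have hm : rootMultiplicity t p ≠ 0 := ((rootMultiplicity_pos hp.ne_zero).2 hpt).ne'
    obtain ⟨h1, h2⟩ := simple_pole_of_im_neg hm hqt hut fun z hz => by
      rw [← hu]; exact h z hz
    rw [h1, pow_one] at hu
    exact ⟨u, hu, hut, h2, by rw [count_roots, h1]⟩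
  choose! u hu hut hα hcount using hpole
  have hnodup : p.roots.Nodup := Multiset.nodup_iff_count_le_one.2 fun t => by
    by_cases ht : t ∈ p.roots
    · exact (hcount t (Multiset.mem_toFinset.2 ht)).le
    · rw [Multiset.count_eq_zero_of_notMem ht]; exact zero_le_one
  have hcard : p.degree = (p.roots.toFinset.card : WithBot ℕ) := by
    rw [Multiset.toFinset_card_of_nodup hnodup, hsplit.degree_eq_card_roots hp.ne_zero]
  refine ⟨p.roots.toFinset, fun t => q.eval t / (u t).eval t, u, q.coeff p.natDegree,
    fun t ht => ?_, fun t ht => (hα t ht).le, hu, ?_⟩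
  · simpa using (hz t (by rw [aeval_ofReal, hroot t ht, Complex.ofReal_zero])).2
  · rw [← sub_eq_zero]
    have hu_deg : ∀ t ∈ p.roots.toFinset, (u t).degree < p.degree := by
      intro t ht
      have h0 : u t ≠ 0 := fun h0 => hut t ht (by rw [h0, eval_zero])
      conv_rhs => rw [hu t ht, degree_mul, degree_X_sub_C, degree_eq_natDegree h0]
      rw [degree_eq_natDegree h0]
      exact_mod_cast Nat.lt_add_of_pos_left one_pos
    -- The choice of `c` cancels the coefficient of degree n, so the difference has degree below the
    -- number of roots of `p`, at all of which it vanishes.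
    refine eq_zero_of_degree_lt_of_eval_finset_eq_zero p.roots.toFinset ?_ fun t ht => ?_
    · rw [← hcard, ← sub_sub]
      refine (degree_sub_le _ _).trans_lt (max_lt ?_ ?_)
      · rw [degree_eq_natDegree hp.ne_zero, degree_lt_iff_coeff_zero]
        intro m hm
        rcases hm.eq_or_lt with rfl | hm
        · simp [hp.coeff_natDegree]
        · have h1 : q.coeff m = 0 :=
            coeff_eq_zero_of_degree_lt (hdeg.trans_lt
              (degree_le_natDegree.trans_lt (by exact_mod_cast hm)))
          simp [h1, coeff_eq_zero_of_natDegree_lt hm]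
      · refine (degree_sum_le _ _).trans_lt ?_
        rw [Finset.sup_lt_iff (by rw [hcard]; exact WithBot.bot_lt_coe _)]
        exact fun t ht => ((degree_mul_le _ _).trans
          (add_le_add_left degree_C_le _)).trans_lt (by rw [zero_add]; exact hu_deg t ht)
    · rw [eval_sub, eval_add, eval_mul, hroot t ht, eval_finsetSum,
        Finset.sum_eq_single_of_mem t ht]
      · simp [div_mul_cancel₀ _ (hut t ht)]
      · intro b hb hbt
        have h1 := hroot t ht
        rw [hu b hb] at h1
        have h2 : (u b).eval t = 0 := by
          simpa [sub_eq_zero, Ne.symm hbt] using h1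
        simp [h2]

lemma eval_ratio {q p : ℝ[X]} {z : ℂ} (hz : aeval z p ≠ 0) :
    (ratio q p).eval (algebraMap ℝ ℂ) z = aeval z q / aeval z p := by
  have hp : p ≠ 0 := by rintro rfl; simp at hz
  have h : (ratio q p).num * p = q * (ratio q p).denom :=
    (RatFunc.num_mul_eq_mul_denom_iff hp).2 rfl
  have hd : aeval z (ratio q p).denom ≠ 0 := by
    obtain ⟨r, hr⟩ := RatFunc.denom_div_dvd q p
    intro h0
    refine hz ?_
    rw [hr, map_mul]
    change aeval z (ratio q p).denom * _ = 0
    rw [h0, zero_mul]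
  have h' := congrArg (aeval z) h
  rw [map_mul, map_mul] at h'
  rw [RatFunc.eval, ← aeval_def, ← aeval_def, div_eq_div_iff hd hz, h']

/-- Decompose the reduced fraction and multiply by the cancelled common factor. -/
lemma exists_partialFractions {q p : ℝ[X]} (hp : p ≠ 0) (hdeg : q.degree ≤ p.degree)
    (hz : HasOnlyNonposZeros p) (hR : IsRFunctionNegType (ratio q p)) :
    ∃ (s : Finset ℝ) (α : ℝ → ℝ) (u : ℝ → ℝ[X]) (c : ℝ), (∀ t ∈ s, t ≤ 0) ∧ (∀ t ∈ s, 0 ≤ α t) ∧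
      (∀ t ∈ s, p = (X - C t) * u t) ∧ q = C c * p + ∑ t ∈ s, C (α t) * u t := by
  set R := ratio q p
  have hqp : R.num * p = q * R.denom := (RatFunc.num_mul_eq_mul_denom_iff hp).2 rfl
  obtain ⟨g, hg⟩ : R.denom ∣ p := RatFunc.denom_div_dvd q p
  have hd0 := R.denom_ne_zero
  have hq : q = R.num * g := by
    refine mul_right_cancel₀ hd0 ?_
    rw [← hqp]; nth_rw 1 [hg]; ring
  have hg0 : g ≠ 0 := by rintro rfl; exact hp (by rw [hg, mul_zero])
  have hdeg' : R.num.degree ≤ R.denom.degree := by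
    rw [hq] at hdeg; nth_rw 1 [hg] at hdeg
    rw [degree_mul, degree_mul] at hdeg
    exact (WithBot.add_le_add_iff_right (degree_ne_bot.2 hg0)).1 hdeg
  obtain ⟨s, α, u, c, hs, hα, hu, hsum⟩ := exists_partialFractions_of_isCoprime R.monic_denom hdeg'
    (fun z h0 => hz z (by rw [hg, map_mul, h0, zero_mul])) R.isCoprime_num_denom
    fun z h0 => hR z h0
  refine ⟨s, α, fun t => u t * g, c, hs, hα, fun t ht => ?_, ?_⟩
  · rw [← mul_assoc, ← hu t ht]; exact hg
  · rw [hq]; nth_rw 1 [hsum]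
    rw [add_mul, Finset.sum_mul, mul_assoc, ← hg]
    simp only [mul_assoc]

/-! ### The Hurwitz matrix in terms of reversed polynomials -/

lemma descCoeff_eq_toeplitz (n : ℕ) {f : ℝ[X]} (hf : f.natDegree ≤ n) (i j : ℕ) :
    descCoeff n f ((j : ℤ) - i) = toeplitz (reflect n f) i j := by
  rcases lt_or_ge j i with h | h
  · rw [toeplitz_of_lt _ h, descCoeff, if_neg (by omega)]
  · obtain ⟨d, rfl⟩ := Nat.exists_eq_add_of_le h
    rw [toeplitz_add, coeff_reflect, descCoeff]
    simp only [Nat.cast_add, add_sub_cancel_left, Nat.cast_nonneg, true_and, Nat.cast_le,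
      Int.toNat_natCast]
    split_ifs with hd
    · rw [revAt_le hd]
    · rw [revAt_eq_self_of_lt (by omega), coeff_eq_zero_of_natDegree_lt (by omega)]

lemma hurwitzMatrix_of_degree_lt {p q : ℝ[X]} (h : q.degree < p.degree) :
    hurwitzMatrix p q =
      interlaced (reflect p.natDegree p) (reflect p.natDegree q) := by
  ext s j
  simp only [hurwitzMatrix, interlaced, if_pos h, descCoeff_eq_toeplitz _ le_rfl,
    descCoeff_eq_toeplitz _ (natDegree_le_natDegree h.le)]

lemma hurwitzMatrix_of_not_degree_lt {p q : ℝ[X]} (hq : q.degree ≤ p.degree)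
    (h : ¬ q.degree < p.degree) :
    hurwitzMatrix p q =
      interlaced (reflect p.natDegree q) (X * reflect p.natDegree p) := by
  ext s j
  have h1 : (j : ℤ) - (s / 2 : ℕ) - 1 = (j : ℤ) - (s / 2 + 1 : ℕ) := by push_cast; ring
  simp only [hurwitzMatrix, interlaced, if_neg h, h1, descCoeff_eq_toeplitz _ le_rfl,
    descCoeff_eq_toeplitz _ (natDegree_le_natDegree hq), toeplitz_X_mul]

lemma interlaced_succ (f g : ℝ[X]) (s j : ℕ) :
    interlaced f g (s + 1) j = interlaced g (X * f) s j := by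
  obtain ⟨i, rfl | rfl⟩ := s.even_or_odd'
  · rw [interlaced_odd, interlaced_even]
  · rw [show 2 * i + 1 + 1 = 2 * (i + 1) by ring, interlaced_even, interlaced_odd, toeplitz_X_mul]

/-- Deleting the first row of the right matrix gives the left one; deleting the first row and column
of the left gives the right. This merges the two cases of the Hurwitz matrix. -/
lemma isTotallyNonneg_interlaced_X_mul_iff (f g : ℝ[X]) :
    IsTotallyNonneg (interlaced g (X * f)) ↔ IsTotallyNonneg (interlaced f g) := by
  constructor
  · intro h
    have h' := h.submatrix (u := fun s => s + 1) (v := fun j => j + 1)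
      (fun _ _ h => Nat.succ_lt_succ h) (fun _ _ h => Nat.succ_lt_succ h)
    convert h' using 1
    ext s j
    rw [Matrix.submatrix_apply, ← interlaced_succ, interlaced_shift]
  · intro h
    have h' := h.submatrix (u := fun s => s + 1) (fun _ _ h => Nat.succ_lt_succ h) strictMono_id
    convert h' using 1
    ext s j
    rw [Matrix.submatrix_apply, interlaced_succ]; rfl

lemma isTotallyNonneg_hurwitzMatrix_iff {p q : ℝ[X]} (hq : q.degree ≤ p.degree) :
    IsTotallyNonneg (hurwitzMatrix p q) ↔
      IsTotallyNonneg
        (interlaced (reflect p.natDegree q) (X * reflect p.natDegree p)) := by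
  by_cases h : q.degree < p.degree
  · rw [hurwitzMatrix_of_degree_lt h, isTotallyNonneg_interlaced_X_mul_iff]
  · rw [hurwitzMatrix_of_not_degree_lt hq h]

lemma aeval_reflect_mul_pow {n : ℕ} {f : ℝ[X]} (hf : f.natDegree ≤ n) {z : ℂ} (hz : z ≠ 0) :
    aeval z⁻¹ (reflect n f) * z ^ n = aeval z f := by
  let _ := invertibleOfNonzero hz
  have h := eval₂_reflect_mul_pow (algebraMap ℝ ℂ) z n f hf
  rwa [invOf_eq_inv] at h

lemma coeff_zero_reflect (n : ℕ) (f : ℝ[X]) : (reflect n f).coeff 0 = f.coeff n := by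
  rw [coeff_reflect, revAt_le (Nat.zero_le _), Nat.sub_zero]

/-- Divisors of the reversed polynomial `reflect n p` have totally nonnegative Toeplitz matrix. -/
lemma isTotallyNonneg_toeplitz_of_dvd_reflect {p d : ℝ[X]} (hp : 0 < p.leadingCoeff)
    (hz : HasOnlyNonposZeros p) (hd : d ∣ reflect p.natDegree p) (hd0 : 0 < d.coeff 0) :
    IsTotallyNonneg (toeplitz d) := by
  have hroot : ∀ z : ℂ, aeval z d = 0 → z.im = 0 ∧ z.re ≤ 0 := by
    intro z h0
    obtain ⟨e, he⟩ := hd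
    have h1 : aeval z (reflect p.natDegree p) = 0 := by rw [he, map_mul, h0, zero_mul]
    have hz0 : z ≠ 0 := by
      rintro rfl
      rw [← coeff_zero_eq_aeval_zero', coeff_zero_reflect] at h1
      exact hp.ne' (by simpa using h1)
    have h2 := aeval_reflect_mul_pow (le_refl p.natDegree) (inv_ne_zero hz0)
    rw [inv_inv, h1, zero_mul] at h2
    obtain ⟨h3, h4⟩ := hz _ h2.symm
    rw [Complex.inv_im, div_eq_zero_iff] at h3
    have h5 : 0 < Complex.normSq z := Complex.normSq_pos.2 hz0
    rw [Complex.inv_re] at h4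
    exact ⟨by simpa [h5.ne'] using h3, by
      by_contra! h6; exact absurd (div_pos h6 h5) h4.not_gt⟩
  have hr : ∀ x ∈ d.roots, x ≤ 0 := fun x hx => by
    have h1 : d.eval x = 0 := (mem_roots'.1 hx).2
    simpa using (hroot x (by rw [aeval_ofReal, h1, Complex.ofReal_zero])).2
  have hs := splits_of_forall_im_eq_zero fun z h0 => (hroot z h0).1
  refine isTotallyNonneg_toeplitz_of_splits hs ?_ hr
  -- Since d(0) is the leading coefficient times ∏(-x) over the roots x ≤ 0, a negative leading
  -- coefficient would contradict d(0) > 0.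
  by_contra! hneg
  have h1 := hs.coeff_zero_eq_leadingCoeff_mul_prod_roots
  have h2 : (-1 : ℝ) ^ d.natDegree * d.roots.prod = (d.roots.map fun x => -x).prod := by
    rw [Multiset.prod_map_neg, hs.natDegree_eq_card_roots]
  have h3 : 0 ≤ (d.roots.map fun x => -x).prod :=
    Multiset.prod_nonneg fun a ha => by
      obtain ⟨x, hx, rfl⟩ := Multiset.mem_map.1 ha
      exact neg_nonneg.2 (hr x hx)
  rw [mul_right_comm, h2] at h1
  nlinarith [mul_nonneg (neg_nonneg.2 hneg.le) h3]

theorem isTotallyNonneg_hurwitzMatrix {p q : ℝ[X]} (hp : 0 < p.leadingCoeff)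
    (hq : q.degree ≤ p.degree) (hz : HasOnlyNonposZeros p) (hq0 : 0 ≤ q.coeff p.natDegree)
    (hR : IsRFunctionNegType (ratio q p) ∨ ∃ c : ℝ, ratio q p = RatFunc.C c) :
    IsTotallyNonneg (hurwitzMatrix p q) := by
  have hp0 : p ≠ 0 := by rintro rfl; simp at hp
  obtain ⟨s, α, u, c, hs, hα, hu, hsum⟩ : ∃ (s : Finset ℝ) (α : ℝ → ℝ) (u : ℝ → ℝ[X]) (c : ℝ),
      (∀ t ∈ s, t ≤ 0) ∧ (∀ t ∈ s, 0 ≤ α t) ∧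
      (∀ t ∈ s, p = (X - C t) * u t) ∧ q = C c * p + ∑ t ∈ s, C (α t) * u t := by
    rcases hR with hR | ⟨c, hc⟩
    · exact exists_partialFractions hp0 hq hz hR
    · refine ⟨∅, 0, 0, c, by simp, by simp, by simp, ?_⟩
      have hp' : algebraMap ℝ[X] (RatFunc ℝ) p ≠ 0 := RatFunc.algebraMap_ne_zero hp0
      rw [ratio, div_eq_iff hp', ← RatFunc.algebraMap_C, ← map_mul] at hc
      simpa using RatFunc.algebraMap_injective ℝ hc
  set n := p.natDegree with hn
  have hun : ∀ t ∈ s, n = 1 + (u t).natDegree := by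
    intro t ht
    have h0 : u t ≠ 0 := fun h0 => hp0 (by rw [hu t ht, h0, mul_zero])
    rw [hn, hu t ht, natDegree_mul (X_sub_C_ne_zero t) h0, natDegree_X_sub_C]
  have hA : ∀ t ∈ s, reflect n p = (1 + C (-t) * X) * reflect (u t).natDegree (u t) := by
    intro t ht
    have h1 : reflect 1 (X - C t) = 1 + C (-t) * X := by
      ext i
      rw [coeff_reflect]
      rcases i with _ | _ | i
      · simp [revAt_le, coeff_X, coeff_C]
      · simp [revAt_le, coeff_X, coeff_C, coeff_one]
      · simp [revAt_eq_self_of_lt, coeff_X, coeff_one]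
    rw [← h1, ← reflect_mul _ _ (natDegree_X_sub_C t).le le_rfl, ← hu t ht, ← hun t ht]
  have hB : reflect n q = C c * reflect n p +
      ∑ t ∈ s, C (α t) * (X * reflect (u t).natDegree (u t)) := by
    have h1 : ∀ t ∈ s, reflect n (u t) = X * reflect (u t).natDegree (u t) := by
      intro t ht
      have h2 := reflect_mul 1 (u t) (F := 1) (natDegree_one.trans_le zero_le_one) le_rfl
      rw [one_mul, ← hun t ht, reflect_one, pow_one] at h2
      exact h2
    rw [hsum, reflect_add, reflect_C_mul]
    congr 1
    ext i
    rw [coeff_reflect, finsetSum_coeff, finsetSum_coeff]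
    refine Finset.sum_congr rfl fun t ht => ?_
    rw [← h1 t ht, coeff_C_mul, coeff_C_mul, coeff_reflect]
  have hc : 0 ≤ c := by
    have h1 : q.coeff n = c * p.leadingCoeff := by
      rw [hsum, coeff_add, finsetSum_coeff, Finset.sum_eq_zero, coeff_C_mul, add_zero]
      · rfl
      · intro t ht
        rw [coeff_C_mul, coeff_eq_zero_of_natDegree_lt (by have := hun t ht; omega), mul_zero]
    rw [h1] at hq0
    exact nonneg_of_mul_nonneg_left hq0 hp
  rw [isTotallyNonneg_hurwitzMatrix_iff hq, ← hn]
  refine isTotallyNonneg_interlaced_of_bezoutian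
    (2 * ((reflect n q).natDegree + (reflect n p).natDegree + 1)) _ _
    (fun i hi => coeff_eq_zero_of_natDegree_lt (by omega))
    (fun i hi => coeff_eq_zero_of_natDegree_lt (by omega)) ?_
    (hasPSDBezoutian_of_partialFractions hα hA hB)
    (hasPSDShiftedBezoutian_of_partialFractions hα (fun t ht => neg_nonneg.2 (hs t ht)) hc hA hB)
    fun d _ hd hd0 => isTotallyNonneg_toeplitz_of_dvd_reflect hp hz hd hd0
  rw [coeff_zero_reflect]; exact hp

/-! ### Totally nonnegative banded Toeplitz matrices -/

/-- Minors obtained by bordering an invertible minor, in terms of its Schur complement. -/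
lemma exists_schurComplement (T : Matrix ℕ ℕ ℝ) {m : ℕ} (I K : Fin m → ℕ)
    (hE : (T.submatrix I K).det ≠ 0) :
    ∃ S : ℕ → ℕ → ℝ,
      (∀ r c, (T.submatrix (Fin.append I ![r]) (Fin.append K ![c])).det =
        (T.submatrix I K).det * S r c) ∧
      (∀ r r' c c', (T.submatrix (Fin.append I ![r, r']) (Fin.append K ![c, c'])).det =
        (T.submatrix I K).det * (S r c * S r' c' - S r c' * S r' c)) ∧
      (∀ r c, (∀ a, T r (K a) = 0) → S r c = T r c) ∧
      ∀ r c, (∀ a, T (I a) c = 0) → S r c = T r c := by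
  set E := T.submatrix I K
  let _ : Invertible E := Matrix.invertibleOfIsUnitDet _ (isUnit_iff_ne_zero.2 hE)
  have key : ∀ (l : ℕ) (r c : Fin l → ℕ),
      (T.submatrix (Fin.append I r) (Fin.append K c)).det =
        E.det * (T.submatrix r c - T.submatrix r K * ⅟E * T.submatrix I c).det := by
    intro l r c
    rw [← Matrix.det_fromBlocks₁₁, ← Matrix.det_submatrix_equiv_self finSumFinEquiv]
    congr 1
    ext (i | i) (j | j) <;> simp [E]
  let S : ℕ → ℕ → ℝ := fun r c => T r c - ∑ b, (∑ a, T r (K a) * (⅟E) a b) * T (I b) c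
  have hS : ∀ (l : ℕ) (r c : Fin l → ℕ) (i j : Fin l),
      (T.submatrix r c - T.submatrix r K * ⅟E * T.submatrix I c) i j = S (r i) (c j) := by
    intro l r c i j
    simp only [Matrix.sub_apply, Matrix.mul_apply, Matrix.submatrix_apply, S]
  refine ⟨S, fun r c => ?_, fun r r' c c' => ?_, fun r c h => ?_, fun r c h => ?_⟩
  · rw [key, Matrix.det_fin_one, hS]; simp
  · rw [key, Matrix.det_fin_two]; simp only [hS]; simp
  · simp [S, h]
  · simp [S, h]

lemma strictMono_append {m l : ℕ} {I : Fin m → ℕ} {J : Fin l → ℕ} (hI : StrictMono I)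
    (hJ : StrictMono J) (h : ∀ a b, I a < J b) : StrictMono (Fin.append I J) := by
  intro a b hab
  induction a using Fin.addCases with
  | left a =>
    induction b using Fin.addCases with
    | left b => simpa using hI (show a < b from hab)
    | right b => simpa using h a b
  | right a =>
    induction b using Fin.addCases with
    | left b => exact absurd hab (by simp [Fin.lt_def]; omega)
    | right b => simpa using hJ (by simpa using hab)

lemma strictMono_vecCons_two {a b : ℕ} (h : a < b) : StrictMono ![a, b] := by
  intro i j hij
  fin_cases i <;> fin_cases j <;> simp_all

/-- Minors whose diagonal lies inside the band are strictly positive. In the induction, the last row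
i and column k are bordered further by row k and column i + n. By triangularity and bandedness those
Schur complement entries are plain Toeplitz entries, so the bordered minor forces S(i,k)·S(k,i+n) ≥
f(0)·lc(f) > 0. -/
lemma toeplitz_submatrix_det_pos {f : ℝ[X]} (hT : IsTotallyNonneg (toeplitz f))
    (h0 : 0 < f.coeff 0) (m : ℕ) : ∀ I K : Fin m → ℕ, StrictMono I → StrictMono K →
    (∀ b, I b ≤ K b ∧ K b ≤ I b + f.natDegree) → 0 < ((toeplitz f).submatrix I K).det := by
  have hf : f ≠ 0 := by rintro rfl; simp at h0
  have hlead : 0 < f.leadingCoeff := by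
    refine lt_of_le_of_ne ?_ (leadingCoeff_ne_zero.2 hf).symm
    have := hT.entry_nonneg 0 (0 + f.natDegree)
    rwa [toeplitz_add] at this
  induction m with
  | zero => intro I K _ _ _; simp
  | succ m ih =>
    intro I K hI hK hIK
    obtain ⟨I, i, rfl⟩ : ∃ (I' : Fin m → ℕ) (i : ℕ), I = Fin.append I' ![i] :=
      ⟨fun a => I (Fin.castAdd 1 a), I (Fin.natAdd m 0), by
        ext a; induction a using Fin.addCases with
        | left a => simp
        | right a => fin_cases a; simp⟩
    obtain ⟨K, k, rfl⟩ : ∃ (K' : Fin m → ℕ) (k : ℕ), K = Fin.append K' ![k] :=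
      ⟨fun a => K (Fin.castAdd 1 a), K (Fin.natAdd m 0), by
        ext a; induction a using Fin.addCases with
        | left a => simp
        | right a => fin_cases a; simp⟩
    have hI' : StrictMono I := fun a b hab => by
      simpa using hI (show Fin.castAdd 1 a < Fin.castAdd 1 b from hab)
    have hK' : StrictMono K := fun a b hab => by
      simpa using hK (show Fin.castAdd 1 a < Fin.castAdd 1 b from hab)
    have hIi : ∀ a, I a < i := fun a => by
      simpa using hI (show Fin.castAdd 1 a < Fin.natAdd m 0 by simp [Fin.lt_def])
    have hKk : ∀ a, K a < k := fun a => by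
      simpa using hK (show Fin.castAdd 1 a < Fin.natAdd m 0 by simp [Fin.lt_def])
    obtain ⟨hik, hki⟩ : i ≤ k ∧ k ≤ i + f.natDegree := by simpa using hIK (Fin.natAdd m 0)
    have hE := ih I K hI' hK' fun b => by simpa using hIK (Fin.castAdd 1 b)
    obtain ⟨S, hS1, hS2, hrow, hcol⟩ := exists_schurComplement (toeplitz f) I K hE.ne'
    rw [hS1]
    refine mul_pos hE ?_
    have hSrow : ∀ c, S k c = toeplitz f k c :=
      fun c => hrow k c fun a => toeplitz_of_lt _ (hKk a)
    have hScol : ∀ r, S r (i + f.natDegree) = toeplitz f r (i + f.natDegree) := by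
      refine fun r => hcol r _ fun a => ?_
      have := hIi a
      rw [toeplitz, if_pos (by omega), coeff_eq_zero_of_natDegree_lt (by omega)]
    have hkk : S k k = f.coeff 0 := by rw [hSrow, toeplitz]; simp
    have hin : S i (i + f.natDegree) = f.leadingCoeff := by rw [hScol, toeplitz_add]; rfl
    rcases hik.eq_or_lt with rfl | hik
    · rw [hkk]; exact h0
    rcases hki.eq_or_lt with hki | hki
    · rw [hki, hin]; exact hlead
    have h2 := hT (m + 2) (Fin.append I ![i, k]) (Fin.append K ![k, i + f.natDegree])
      (strictMono_append hI' (strictMono_vecCons_two hik) fun a b => by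
        have := hIi a; fin_cases b <;> simp <;> omega)
      (strictMono_append hK' (strictMono_vecCons_two hki) fun a b => by
        have := hKk a; fin_cases b <;> simp <;> omega)
    rw [hS2, hin, hkk] at h2
    have h3 := nonneg_of_mul_nonneg_right h2 hE
    have h4 : 0 ≤ S k (i + f.natDegree) := by rw [hSrow]; exact hT.entry_nonneg _ _
    have h5 := mul_pos hlead h0
    by_contra! h6
    nlinarith [mul_nonneg (neg_nonneg.2 h6) h4]

/-! ### Sign changes of sequences annihilated by a Toeplitz matrix -/

/-- The number of sign changes of `v 0, …, v k`. -/
def signChanges (v : ℕ → ℝ) (k : ℕ) : ℕ := by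
  classical exact Nat.count (fun j => ¬ 0 < v j * v (j + 1)) k

lemma signChanges_succ (v : ℕ → ℝ) (k : ℕ) :
    signChanges v (k + 1) = signChanges v k + if 0 < v k * v (k + 1) then 0 else 1 := by
  classical
  rw [signChanges, Nat.count_succ, signChanges]
  by_cases h : 0 < v k * v (k + 1) <;> simp [h]

lemma signChanges_monotone (v : ℕ → ℝ) : Monotone (signChanges v) :=
  monotone_nat_of_le_succ fun k => by rw [signChanges_succ]; exact Nat.le_add_right _ _

lemma exists_signChanges_eq (v : ℕ → ℝ) (M b : ℕ) (hb : b ≤ signChanges v M) :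
    ∃ k ≤ M, signChanges v k = b := by
  induction M with
  | zero =>
    have h : signChanges v 0 = 0 := by simp [signChanges]
    exact ⟨0, le_rfl, by omega⟩
  | succ M ih =>
    rcases hb.eq_or_lt with h | h
    · exact ⟨M + 1, le_rfl, h.symm⟩
    · obtain ⟨k, hk, hkb⟩ := ih (by rw [signChanges_succ] at h; split_ifs at h <;> omega)
      exact ⟨k, hk.trans M.le_succ, hkb⟩

lemma mul_pos_of_signChanges_eq {v : ℕ → ℝ} (hv : ∀ k, v k ≠ 0) {k l : ℕ}
    (h : signChanges v k = signChanges v l) : 0 < v k * v l := by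
  wlog hkl : k ≤ l generalizing k l
  · rw [mul_comm]; exact this h.symm (not_le.1 hkl).le
  obtain ⟨d, rfl⟩ := Nat.exists_eq_add_of_le hkl
  clear hkl
  induction d with
  | zero => exact mul_self_pos.2 (hv k)
  | succ d ih =>
    have h1 := signChanges_monotone v (Nat.le_add_right k d)
    rw [← add_assoc, signChanges_succ] at h
    split_ifs at h with h2
    · have h3 := ih (by simpa using h)
      rw [← add_assoc]
      have h4 : 0 < v k * v (k + d + 1) * (v (k + d) * v (k + d)) := by
        have := mul_pos h3 h2; linarith
      exact pos_of_mul_pos_left h4 (mul_self_nonneg _)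
    · omega

/-- A sequence without zeros annihilated by a totally nonnegative Toeplitz matrix of bandwidth `n`
has more than `M - n` sign changes up to `M`. -/
lemma lt_signChanges_add {f : ℝ[X]} (hT : IsTotallyNonneg (toeplitz f)) (h0 : 0 < f.coeff 0)
    {v : ℕ → ℝ} (hv : ∀ k, v k ≠ 0)
    (hker : ∀ i, ∑ j ∈ Finset.range (f.natDegree + 1), f.coeff j * v (i + j) = 0) (M : ℕ) :
    M < signChanges v M + f.natDegree := by
  classical
  by_contra! hM
  set n := f.natDegree with hn
  set B := signChanges v M + 1 with hB
  let A : Fin B → Finset ℕ := fun b => (Finset.range (M + 1)).filter fun k => signChanges v k = b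
  have hA : ∀ b k, k ∈ A b ↔ k ≤ M ∧ signChanges v k = b := fun b k => by
    simp [A]
  have hex : ∀ b : Fin B, ∃ k, k ∈ A b := fun b => by
    obtain ⟨k, hk, hkb⟩ := exists_signChanges_eq v M b (Nat.lt_succ_iff.1 b.2)
    exact ⟨k, (hA b k).2 ⟨hk, hkb⟩⟩
  choose K hK using hex
  have hmono : ∀ r : Fin B → ℕ, (∀ b, r b ∈ A b) → StrictMono r := by
    intro r hr a b hab
    by_contra! hle
    have h1 := signChanges_monotone v hle
    rw [((hA _ _).1 (hr a)).2, ((hA _ _).1 (hr b)).2] at h1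
    exact absurd hab (not_lt.2 h1)
  have hKmono := hmono K hK
  have hbK : ∀ b : Fin B, (b : ℕ) ≤ K b := by
    intro b
    rw [← ((hA _ _).1 (hK b)).2]
    exact Nat.count_le _
  -- These rows keep I b ≤ K b ≤ I b + n, and the band of each row ends by column M.
  let I : Fin B → ℕ := fun b => max (K b - n) b
  have hImono : StrictMono I := by
    intro a b hab
    have h1 := hKmono hab
    have h2 : (a : ℕ) < b := hab
    simp only [I]; omega
  have hIM : ∀ b, I b + n ≤ M := by
    intro b
    have h1 := ((hA _ _).1 (hK b)).1
    have h2 := b.2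
    simp only [I]; omega
  -- Columns are merged over blocks of constant sign. The determinant is a sum of nonnegative
  -- minors, the one for `K` positive, yet the vector of block signs annihilates `Y`.
  let Y : Matrix (Fin B) (Fin B) ℝ := fun b a => ∑ k ∈ A b, |v k| * toeplitz f (I a) k
  have hY : 0 < Y.det := by
    have h1 := (Matrix.detRowAlternating (n := Fin B) (R := ℝ)).toMultilinearMap.map_sum_finset
      (fun b k a => |v k| * toeplitz f (I a) k) A
    have h2 : ∀ r : Fin B → ℕ, Matrix.det (fun b a => |v (r b)| * toeplitz f (I a) (r b)) =
        (∏ b, |v (r b)|) * ((toeplitz f).submatrix I r).det := by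
      intro r
      rw [← Matrix.det_transpose ((toeplitz f).submatrix I r), ← Matrix.det_mul_column]
      rfl
    have h3 : Y.det = ∑ r ∈ Fintype.piFinset A,
        (∏ b, |v (r b)|) * ((toeplitz f).submatrix I r).det := by
      simp only [← h2]
      refine Eq.trans (congrArg Matrix.det ?_) h1
      ext b a
      simp [Y]
    rw [h3]
    refine Finset.sum_pos' (fun r hr => ?_) ⟨K, Fintype.mem_piFinset.2 hK, ?_⟩
    · exact mul_nonneg (Finset.prod_nonneg fun b _ => abs_nonneg _)
        (hT _ _ _ hImono (hmono r (Fintype.mem_piFinset.1 hr)))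
    · refine mul_pos (Finset.prod_pos fun b _ => abs_pos.2 (hv _))
        (toeplitz_submatrix_det_pos hT h0 B I K hImono hKmono fun b => ?_)
      have := hbK b
      simp only [I]; omega
  refine hY.ne' ((Matrix.exists_vecMul_eq_zero_iff).1
    ⟨fun b => v (K b) / |v (K b)|, fun h => ?_, ?_⟩)
  · have := congrFun h ⟨0, Nat.succ_pos _⟩
    exact div_ne_zero (hv _) (abs_ne_zero.2 (hv _)) this
  · ext a
    have h1 : ∀ b, ∀ k ∈ A b, v (K b) / |v (K b)| * (|v k| * toeplitz f (I a) k) =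
        toeplitz f (I a) k * v k := by
      intro b k hk
      have h2 : 0 < v (K b) * v k := mul_pos_of_signChanges_eq hv (by
        rw [((hA _ _).1 (hK b)).2, ((hA _ _).1 hk).2])
      have h3 : v (K b) / |v (K b)| * |v k| = v k := by
        rcases pos_and_pos_or_neg_and_neg_of_mul_pos h2 with ⟨h4, h5⟩ | ⟨h4, h5⟩
        · rw [abs_of_pos h4, abs_of_pos h5, div_self h4.ne', one_mul]
        · rw [abs_of_neg h4, abs_of_neg h5, div_neg, div_self h4.ne]; ring
      rw [← mul_assoc, h3, mul_comm]
    simp only [Matrix.vecMul, dotProduct, Y, Finset.mul_sum, Pi.zero_apply]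
    rw [Finset.sum_congr rfl fun b _ => Finset.sum_congr rfl (h1 b)]
    have h4 : ∑ b, ∑ k ∈ A b, toeplitz f (I a) k * v k =
        ∑ k ∈ Finset.range (M + 1), toeplitz f (I a) k * v k := by
      have hmem : ∀ k ∈ Finset.range (M + 1), signChanges v k < B := fun k hk =>
        Nat.lt_succ_iff.2 (signChanges_monotone v (Nat.lt_succ_iff.1 (Finset.mem_range.1 hk)))
      rw [← Finset.sum_biUnion]
      · refine Finset.sum_congr ?_ fun _ _ => rfl
        ext k
        simp only [Finset.mem_biUnion, Finset.mem_univ, true_and, hA, Finset.mem_range,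
          Nat.lt_succ_iff]
        exact ⟨fun ⟨b, hb⟩ => hb.1,
          fun hk => ⟨⟨_, hmem k (Finset.mem_range.2 (Nat.lt_succ_iff.2 hk))⟩, hk, rfl⟩⟩
      · intro b _ b' _ hbb
        refine Finset.disjoint_left.2 fun k hk hk' => hbb (Fin.ext ?_)
        rw [← ((hA _ _).1 hk).2, ← ((hA _ _).1 hk').2]
    rw [h4, ← hker (I a)]
    obtain ⟨d, hd⟩ := Nat.exists_eq_add_of_le (hIM a)
    rw [show M + 1 = I a + (n + 1 + d) by omega, Finset.sum_range_add, Finset.sum_range_add,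
      Finset.sum_eq_zero fun k hk => by rw [toeplitz_of_lt _ (Finset.mem_range.1 hk), zero_mul],
      Finset.sum_eq_zero (s := Finset.range d) fun k _ => by
        rw [toeplitz_add, coeff_eq_zero_of_natDegree_lt (by omega), zero_mul]]
    simp only [zero_add, add_zero, toeplitz_add]

/-- A real solution of a second order recurrence with nonreal characteristic roots does not
eventually alternate in sign. -/
lemma infinite_setOf_mul_succ_pos {v : ℕ → ℝ} (hv : ∀ k, v k ≠ 0) {r ρ : ℝ} (hr : r ^ 2 < ρ)
    (hrec : ∀ k, v (k + 2) = 2 * r * v (k + 1) - ρ * v k) :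
    {k | 0 < v k * v (k + 1)}.Infinite := by
  intro hfin
  obtain ⟨k₀, hk₀⟩ := hfin.bddAbove
  have hneg : ∀ m, v (k₀ + 1 + m + 1) / v (k₀ + 1 + m) < 0 := by
    intro m
    have h1 : ¬ 0 < v (k₀ + 1 + m) * v (k₀ + 1 + m + 1) := fun h => by
      have := hk₀ h; omega
    have h2 := lt_of_le_of_ne (not_lt.1 h1) (mul_ne_zero (hv _) (hv _))
    rw [div_neg_iff]
    rcases mul_neg_iff.1 h2 with h | h
    · exact Or.inr ⟨h.2, h.1⟩
    · exact Or.inl ⟨h.2, h.1⟩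
  -- Eventual alternation keeps these ratios negative, but the recurrence increases them by at least
  -- a fixed positive amount at each step.
  set t : ℕ → ℝ := fun m => v (k₀ + 1 + m + 1) / v (k₀ + 1 + m) with ht
  have hstep : ∀ m, t (m + 1) * t m = 2 * r * t m - ρ := by
    intro m
    have h1 := hv (k₀ + 1 + m)
    have h2 := hv (k₀ + 1 + m + 1)
    have h3 := hrec (k₀ + 1 + m)
    simp only [ht]
    rw [show k₀ + 1 + (m + 1) + 1 = k₀ + 1 + m + 2 by ring,
      show k₀ + 1 + (m + 1) = k₀ + 1 + m + 1 by ring, h3]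
    field_simp
  have hδ : 0 < (ρ - r ^ 2) / -t 0 := div_pos (by linarith) (by have := hneg 0; linarith)
  have hgrow : ∀ m : ℕ, t 0 + m * ((ρ - r ^ 2) / -t 0) ≤ t m := by
    intro m
    induction m with
    | zero => simp
    | succ m ih =>
      have h1 : t m < 0 := hneg m
      have h2 : t 0 ≤ t m := le_trans (by
        have : (0 : ℝ) ≤ m * ((ρ - r ^ 2) / -t 0) := by positivity
        linarith) ih
      have h3 : t (m + 1) - t m = ((t m - r) ^ 2 + (ρ - r ^ 2)) / -t m := by
        rw [eq_div_iff (by linarith)]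
        linear_combination -(hstep m)
      have h4 : (ρ - r ^ 2) / -t 0 ≤ ((t m - r) ^ 2 + (ρ - r ^ 2)) / -t m :=
        div_le_div₀ (by nlinarith [sq_nonneg (t m - r)]) (by nlinarith [sq_nonneg (t m - r)])
          (by linarith) (by linarith)
      push_cast
      linarith
  obtain ⟨m, hm⟩ := Archimedean.arch (-t 0) hδ
  rw [nsmul_eq_mul] at hm
  have h1 := hgrow m
  have h2 : t m < 0 := hneg m
  linarith

/-- The **Aissen–Schoenberg–Whitney theorem** for polynomials: the zeros of a polynomial whose
coefficient sequence is totally nonnegative are real. -/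
theorem im_eq_zero_of_isTotallyNonneg_toeplitz_of_coeff_zero_pos {f : ℝ[X]}
    (hT : IsTotallyNonneg (toeplitz f)) (h0 : 0 < f.coeff 0) {z : ℂ} (hz : aeval z f = 0) :
    z.im = 0 := by
  by_contra him
  have hz0 : z ≠ 0 := by rintro rfl; simp at him
  -- Only countably many τ are bad; a good one makes the sequence Re((1 + iτ) z^k) zero-free.
  obtain ⟨τ, hτ⟩ : ∃ τ : ℝ, ∀ k : ℕ, (z ^ k).re - τ * (z ^ k).im ≠ 0 := by
    have hcount : (Set.range fun k : ℕ => (z ^ k).re / (z ^ k).im).Countable :=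
      Set.countable_range _
    obtain ⟨τ, hτ⟩ : ∃ τ : ℝ, τ ∉ Set.range fun k : ℕ => (z ^ k).re / (z ^ k).im := by
      by_contra! h
      exact Set.not_countable_univ (hcount.mono fun x _ => h x)
    refine ⟨τ, fun k hk => ?_⟩
    by_cases hk0 : (z ^ k).im = 0
    · exact pow_ne_zero k hz0 (Complex.ext (by simpa [hk0] using hk) hk0)
    · exact hτ ⟨k, by simp only; rw [div_eq_iff hk0]; linarith⟩
  set v : ℕ → ℝ := fun k => ((1 + τ * Complex.I) * z ^ k).re with hv
  have hv0 : ∀ k, v k ≠ 0 := fun k => by simpa [hv] using hτ k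
  have hrec : ∀ k, v (k + 2) = 2 * z.re * v (k + 1) - Complex.normSq z * v k := by
    intro k
    have h1 : z ^ 2 = ((2 * z.re : ℝ) : ℂ) * z - (Complex.normSq z : ℝ) := by
      apply Complex.ext <;> simp [sq, Complex.normSq_apply] <;> ring
    have h2 : (1 + τ * Complex.I) * z ^ (k + 2) =
        ((2 * z.re : ℝ) : ℂ) * ((1 + τ * Complex.I) * z ^ (k + 1)) -
          (Complex.normSq z : ℝ) * ((1 + τ * Complex.I) * z ^ k) := by
      rw [pow_add, h1]; ring
    simp only [hv]
    rw [h2, Complex.sub_re, Complex.re_ofReal_mul, Complex.re_ofReal_mul]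
  have hker : ∀ i, ∑ j ∈ Finset.range (f.natDegree + 1), f.coeff j * v (i + j) = 0 := by
    intro i
    have h1 : ∑ j ∈ Finset.range (f.natDegree + 1),
        ((f.coeff j : ℝ) : ℂ) * ((1 + τ * Complex.I) * z ^ (i + j)) =
        (1 + τ * Complex.I) * z ^ i * aeval z f := by
      rw [aeval_eq_sum_range, Finset.mul_sum]
      refine Finset.sum_congr rfl fun j _ => ?_
      rw [Complex.real_smul, pow_add]; ring
    have h2 := congrArg Complex.re h1
    rw [hz, mul_zero, Complex.re_sum] at h2
    simpa only [Complex.re_ofReal_mul, Complex.zero_re] using h2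
  have hinf := infinite_setOf_mul_succ_pos hv0 (r := z.re) (ρ := Complex.normSq z)
    (by rw [Complex.normSq_apply]; nlinarith [mul_self_pos.2 him]) hrec
  classical
  -- At this index exactly n steps without sign change have occurred, while the bound allows fewer
  -- than n.
  have h1 := lt_signChanges_add hT h0 hv0 hker (Nat.nth (fun k => 0 < v k * v (k + 1)) f.natDegree)
  have h2 := Nat.count_nth_of_infinite hinf f.natDegree
  have h3 : ∀ k, signChanges v k + Nat.count (fun k => 0 < v k * v (k + 1)) k = k := by
    intro k
    induction k with
    | zero => simp [signChanges]
    | succ k ih => rw [signChanges_succ, Nat.count_succ]; split_ifs <;> omega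
  have h4 := h3 (Nat.nth (fun k => 0 < v k * v (k + 1)) f.natDegree)
  omega

theorem im_eq_zero_of_isTotallyNonneg_toeplitz {f : ℝ[X]} (hf : f ≠ 0)
    (hT : IsTotallyNonneg (toeplitz f)) {z : ℂ} (hz : aeval z f = 0) : z.im = 0 := by
  induction hn : f.natDegree generalizing f with
  | zero =>
    rw [eq_C_of_natDegree_eq_zero hn] at hz hf
    simp at hz hf
    exact absurd hz hf
  | succ n ih =>
    have h00 : 0 ≤ f.coeff 0 := by simpa [toeplitz] using hT.entry_nonneg 0 0
    -- A factor X is removed by deleting the first column.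
    rcases h00.eq_or_lt with h0 | h0
    · have hX : f = X * f.divX := by
        have := divX_mul_X_add f
        rwa [← h0, C_0, add_zero, mul_comm, eq_comm] at this
      rw [hX, map_mul, aeval_X, mul_eq_zero] at hz
      rcases hz with rfl | hz
      · rfl
      · refine ih (fun h => hf (by rw [hX, h, mul_zero])) ?_ hz
          (by rw [natDegree_divX_eq_natDegree_tsub_one, hn]; rfl)
        have h1 := hT.submatrix (v := fun j => j + 1) strictMono_id
          (fun _ _ h => Nat.succ_lt_succ h)
        convert h1 using 1
        ext i j
        nth_rw 2 [hX]
        rw [Matrix.submatrix_apply, toeplitz_X_mul, id, toeplitz_succ_succ]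
    · exact im_eq_zero_of_isTotallyNonneg_toeplitz_of_coeff_zero_pos hT h0 hz

/-! ### Euclidean division and minors with consecutive rows -/

/-- All minors formed from consecutive rows are nonnegative. -/
def HasNonnegConsecutiveMinors (A : Matrix ℕ ℕ ℝ) : Prop :=
  ∀ (k s : ℕ) (c : Fin k → ℕ), StrictMono c →
    0 ≤ (A.submatrix (fun a : Fin k => s + a) c).det

lemma IsTotallyNonneg.hasNonnegConsecutiveMinors {A : Matrix ℕ ℕ ℝ} (hA : IsTotallyNonneg A) :
    HasNonnegConsecutiveMinors A :=
  fun k s c hc => hA k _ c (fun _ _ h => Nat.add_lt_add_left h s) hc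

lemma HasNonnegConsecutiveMinors.entry_nonneg {A : Matrix ℕ ℕ ℝ}
    (hA : HasNonnegConsecutiveMinors A) (i j : ℕ) : 0 ≤ A i j := by
  simpa using hA 1 i (fun _ => j) (Subsingleton.strictMono _)

section Step

variable {c : ℝ} {g k : ℝ[X]}

/-- Nonnegative minors of `interlaced g (X * k)` whose first row is a row of `toeplitz g`. -/
lemma interlaced_minor_nonneg_of_even
    (h : HasNonnegConsecutiveMinors (interlaced (C c * g + X * k) (X * g))) (l i : ℕ)
    (d : Fin l → ℕ) (hd : StrictMono d) :
    0 ≤ ((interlaced g (X * k)).submatrix (fun a : Fin l => 2 * i + 2 + a) d).det := by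
  rcases l with _ | l
  · simp
  -- The first rows agree, and each later row differs by 0 or c times the preceding row, so the
  -- determinants are equal.
  refine (h (l + 1) (2 * i + 1) d hd).trans_eq (Eq.symm ?_)
  refine Matrix.det_eq_of_forall_row_eq_smul_add_pred
    (fun a : Fin l => if Even (a : ℕ) then -c else 0) (fun b => ?_) fun a b => ?_
  · simp only [Matrix.submatrix_apply, Fin.val_zero, add_zero]
    rw [show 2 * i + 2 = 2 * (i + 1) by ring, interlaced_even, interlaced_odd, toeplitz_X_mul]
  · simp only [Matrix.submatrix_apply, Fin.val_succ, Fin.val_castSucc]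
    obtain ⟨m, hm | hm⟩ := (a : ℕ).even_or_odd'
    · rw [hm, show 2 * i + 2 + (2 * m + 1) = 2 * (i + m + 1) + 1 by ring,
        show 2 * i + 1 + (2 * m + 1) = 2 * (i + m + 1) by ring,
        show 2 * i + 2 + 2 * m = 2 * (i + m + 1) by ring, interlaced_odd, interlaced_even,
        interlaced_even, toeplitz_add_poly, toeplitz_C_mul]
      simp
    · rw [hm, show 2 * i + 2 + (2 * m + 1 + 1) = 2 * (i + m + 2) by ring,
        show 2 * i + 1 + (2 * m + 1 + 1) = 2 * (i + m + 1) + 1 by ring, interlaced_odd,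
        interlaced_even, toeplitz_X_mul]
      simp

/-- Border by the preceding even row and column i + 1: that column is g(0) on top and zero below, so
the even case gives g(0) times the minor. -/
lemma interlaced_minor_nonneg_of_odd (hg : 0 < g.coeff 0)
    (h : HasNonnegConsecutiveMinors (interlaced (C c * g + X * k) (X * g))) (l i : ℕ)
    (d : Fin l → ℕ) (hd : StrictMono d) :
    0 ≤ ((interlaced g (X * k)).submatrix (fun a : Fin l => 2 * i + 3 + a) d).det := by
  rcases l with _ | l
  · simp
  have hzero : ∀ a j, j ≤ i + 1 → interlaced g (X * k) (2 * i + 3 + a) j = 0 := by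
    intro a j hj
    obtain ⟨m, rfl | rfl⟩ := a.even_or_odd'
    · rw [show 2 * i + 3 + 2 * m = 2 * (i + m + 1) + 1 by ring, interlaced_odd, toeplitz_X_mul,
        toeplitz_of_lt _ (by omega)]
    · rw [show 2 * i + 3 + (2 * m + 1) = 2 * (i + m + 2) by ring, interlaced_even,
        toeplitz_of_lt _ (by omega)]
  rcases le_or_gt (d 0) (i + 1) with h0 | h0
  · rw [Matrix.det_eq_zero_of_column_eq_zero (0 : Fin (l + 1)) fun a => hzero _ _ h0]
  · have h1 := interlaced_minor_nonneg_of_even h (l + 2) i (Matrix.vecCons (i + 1) d) (by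
      rw [Fin.strictMono_iff_lt_succ]
      intro a
      refine Fin.cases ?_ (fun a => ?_) a
      · simpa using h0
      · simpa [← Fin.succ_castSucc] using hd (Fin.castSucc_lt_succ (i := a)))
    rw [Matrix.det_succ_column_zero, Fin.sum_univ_succ, Finset.sum_eq_zero, add_zero] at h1
    · have h2 : interlaced g (X * k) (2 * i + 2) (i + 1) = g.coeff 0 := by
        rw [show 2 * i + 2 = 2 * (i + 1) by ring, interlaced_even]; simp [toeplitz]
      simp only [Fin.val_zero, pow_zero, one_mul, Matrix.submatrix_apply, add_zero,
        Matrix.cons_val_zero, h2] at h1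
      refine (nonneg_of_mul_nonneg_right h1 hg).trans_eq (congrArg Matrix.det ?_)
      ext a b
      simp only [Matrix.submatrix_apply, Fin.zero_succAbove, Fin.val_succ, Matrix.cons_val_succ]
      rw [show 2 * i + 2 + (a + 1 : ℕ) = 2 * i + 3 + a by ring]
    · intro a _
      simp only [Matrix.submatrix_apply, Fin.val_succ, Matrix.cons_val_zero]
      rw [show 2 * i + 2 + (a + 1 : ℕ) = 2 * i + 3 + a by ring, hzero _ _ le_rfl]
      ring

/-- Shifting by two rows and one column first guarantees the earlier rows needed for elimination. -/
lemma HasNonnegConsecutiveMinors.interlaced_step (hg : 0 < g.coeff 0)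
    (h : HasNonnegConsecutiveMinors (interlaced (C c * g + X * k) (X * g))) :
    HasNonnegConsecutiveMinors (interlaced g (X * k)) := by
  intro l s d hd
  have hd' : StrictMono fun b => d b + 1 := fun _ _ hab => Nat.succ_lt_succ (hd hab)
  have hshift : (interlaced g (X * k)).submatrix (fun a : Fin l => s + a) d =
      (interlaced g (X * k)).submatrix (fun a : Fin l => s + 2 + a) fun b => d b + 1 := by
    ext a b
    rw [Matrix.submatrix_apply, Matrix.submatrix_apply, ← interlaced_shift,
      show s + 2 + (a : ℕ) = s + a + 2 by ring]
  rw [hshift]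
  obtain ⟨i, rfl | rfl⟩ := s.even_or_odd'
  · exact interlaced_minor_nonneg_of_even h l i _ hd'
  · exact interlaced_minor_nonneg_of_odd hg h l i _ hd'

/-- The minor on rows 1, 2 and columns 1, j + 2 equals -g(0) k_{j+1}. -/
lemma HasNonnegConsecutiveMinors.eq_zero (hg : 0 < g.coeff 0)
    (h : HasNonnegConsecutiveMinors (interlaced g (X * k))) (hk : k.coeff 0 = 0) : k = 0 := by
  ext j
  rw [coeff_zero]
  rcases j with _ | j
  · exact hk
  have h1 : 0 ≤ k.coeff (j + 1) := by
    have := h.entry_nonneg 1 (1 + (j + 1))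
    rwa [show interlaced g (X * k) 1 = interlaced g (X * k) (2 * 0 + 1) from rfl, interlaced_odd,
      toeplitz_X_mul, toeplitz_add] at this
  have h2 := h 2 1 ![1, 1 + (j + 1)] (strictMono_vecCons_two (by omega))
  have e1 : interlaced g (X * k) 1 1 = 0 := by
    have := interlaced_odd g (X * k) 0 1
    rw [toeplitz_X_mul] at this
    simpa [toeplitz, hk] using this
  have e2 : interlaced g (X * k) 1 (1 + (j + 1)) = k.coeff (j + 1) := by
    have := interlaced_odd g (X * k) 0 (1 + (j + 1))
    rwa [toeplitz_X_mul, toeplitz_add] at this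
  have e3 : interlaced g (X * k) 2 1 = g.coeff 0 := by
    have := interlaced_even g (X * k) 1 (1 + 0)
    rwa [toeplitz_add] at this
  rw [Matrix.det_fin_two] at h2
  simp [e1, e2, e3] at h2
  exact le_antisymm (by nlinarith) h1

end Step

/-- The two sign statements go together because a division step exchanges them: Im(f ḡ) = -Im(z̄ g
k̄) and Im(z̄ f ḡ) = -c Im z |g|² - |z|² Im(g k̄). -/
theorem im_pos_of_hasNonnegConsecutiveMinors (N : ℕ) : ∀ f g : ℝ[X],
    (∀ i, N ≤ 2 * i → f.coeff i = 0) → (∀ i, N ≤ 2 * i + 1 → g.coeff i = 0) → 0 < g.coeff 0 →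
    HasNonnegConsecutiveMinors (interlaced f (X * g)) →
    (∀ z : ℂ, 0 < z.im → aeval z f = 0 → aeval z g ≠ 0) →
    ((∃ c : ℝ, f = C c * g) ∨
      ∀ z : ℂ, 0 < z.im → 0 < (aeval z f * starRingEnd ℂ (aeval z g)).im) ∧
    (0 < f.coeff 0 → ∀ z : ℂ, 0 < z.im →
      (starRingEnd ℂ z * aeval z f * starRingEnd ℂ (aeval z g)).im < 0) := by
  induction N with
  | zero =>
    intro f g _ hg hg0
    exact absurd (hg 0 (Nat.zero_le _)) hg0.ne'
  | succ N ih =>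
    intro f g hf hg hg0 hM hz
    have hc0 : f.coeff 0 = f.coeff 0 / g.coeff 0 * g.coeff 0 := (div_mul_cancel₀ _ hg0.ne').symm
    have hfk := eq_C_mul_add_X_mul_divX (f := f) hg0.ne'
    generalize f.coeff 0 / g.coeff 0 = c at hc0 hfk
    generalize (f - C c * g).divX = k at hfk
    have hcpos : 0 < f.coeff 0 → 0 < c := fun h => by
      rw [hc0] at h; exact pos_of_mul_pos_left h hg0.le
    have hev : ∀ z : ℂ, aeval z f = c * aeval z g + z * aeval z k := fun z => by
      rw [hfk]; simp
    have hM' : HasNonnegConsecutiveMinors (interlaced g (X * k)) := by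
      rw [hfk] at hM; exact hM.interlaced_step hg0
    have hN2 : ∀ z : ℂ, (starRingEnd ℂ z * aeval z f * starRingEnd ℂ (aeval z g)).im =
        -(c * z.im * Complex.normSq (aeval z g)) -
          Complex.normSq z * (aeval z g * starRingEnd ℂ (aeval z k)).im := fun z => by
      rw [hev]
      simp [Complex.normSq_apply]
      ring
    have hN1 : ∀ z : ℂ, (aeval z f * starRingEnd ℂ (aeval z g)).im =
        -(starRingEnd ℂ z * aeval z g * starRingEnd ℂ (aeval z k)).im := fun z => by
      rw [hev]
      simp
      ring
    have hk0 : 0 ≤ k.coeff 0 := by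
      have h1 := hM'.entry_nonneg 1 1
      have h2 := interlaced_odd g (X * k) 0 1
      rw [toeplitz_X_mul] at h2
      rw [show (1 : ℕ) = 2 * 0 + 1 from rfl, h2] at h1
      simpa [toeplitz] using h1
    rcases hk0.eq_or_lt with hk0 | hk0
    · obtain rfl := hM'.eq_zero hg0 hk0.symm
      rw [mul_zero, add_zero] at hfk
      refine ⟨Or.inl ⟨c, hfk⟩, fun hf0 z hzim => ?_⟩
      have hgz : aeval z g ≠ 0 := fun h0 => hz z hzim (by rw [hev, h0]; simp) h0
      rw [hN2]
      have := mul_pos (mul_pos (hcpos hf0) hzim) (Complex.normSq_pos.2 hgz)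
      simpa using this
    · obtain ⟨h1, h2⟩ := ih g k (fun i hi => hg i (by omega)) (fun i hi => by
        have h1 := hf (i + 1) (by omega)
        rw [hfk] at h1
        simpa [hg (i + 1) (by omega)] using h1) hk0 hM' fun z hzim h0 h0' =>
          hz z hzim (by rw [hev, h0, h0']; simp) h0
      refine ⟨Or.inr fun z hzim => ?_, fun hf0 z hzim => ?_⟩
      · rw [hN1]; exact neg_pos.2 (h2 hg0 z hzim)
      · have hgz : aeval z g ≠ 0 := fun h0 => by
          have := h2 hg0 z hzim
          simp [h0] at this
        have h3 := mul_pos (mul_pos (hcpos hf0) hzim) (Complex.normSq_pos.2 hgz)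
        have h4 : 0 ≤ (aeval z g * starRingEnd ℂ (aeval z k)).im := by
          rcases h1 with ⟨e, he⟩ | h1
          · rw [he]
            simp
            ring_nf
            rfl
          · exact (h1 z hzim).le
        rw [hN2]
        nlinarith [mul_nonneg (Complex.normSq_nonneg z) h4]

/-! ### Total nonnegativity of the Hurwitz matrix -/

/-- Nonzero zeros are inverses of zeros of the reversal, hence real; nonnegative coefficients
exclude positive ones. -/
lemma hasOnlyNonposZeros_of_isTotallyNonneg_toeplitz {n : ℕ} {f : ℝ[X]} (hf : f ≠ 0)
    (hn : f.natDegree ≤ n) (hT : IsTotallyNonneg (toeplitz (reflect n f))) :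
    HasOnlyNonposZeros f := by
  intro z hz
  rcases eq_or_ne z 0 with rfl | hz0
  · simp
  have hr : reflect n f ≠ 0 := by simpa using hf
  have him : z.im = 0 := by
    have h1 := aeval_reflect_mul_pow hn hz0
    rw [hz, mul_eq_zero, or_iff_left (pow_ne_zero _ hz0)] at h1
    have h2 := im_eq_zero_of_isTotallyNonneg_toeplitz hr hT h1
    rw [Complex.inv_im, div_eq_zero_iff, or_iff_left (Complex.normSq_pos.2 hz0).ne'] at h2
    simpa using h2
  refine ⟨him, ?_⟩
  by_contra! hpos
  have hcoeff : ∀ j, 0 ≤ f.coeff j := by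
    intro j
    rcases le_or_gt j n with hj | hj
    · have h1 := hT.entry_nonneg 0 (0 + (n - j))
      rwa [toeplitz_add, coeff_reflect, revAt_le (Nat.sub_le _ _), Nat.sub_sub_self hj] at h1
    · rw [coeff_eq_zero_of_natDegree_lt (by omega)]
  have hz' : z = (z.re : ℂ) := Complex.ext rfl (by simp [him])
  rw [hz', aeval_ofReal, Complex.ofReal_eq_zero, eval_eq_sum_range] at hz
  refine absurd hz (ne_of_gt (Finset.sum_pos' (fun j _ => mul_nonneg (hcoeff j) (by positivity))
    ⟨f.natDegree, by simp, mul_pos ?_ (by positivity)⟩))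
  exact lt_of_le_of_ne (hcoeff _) (leadingCoeff_ne_zero.2 hf).symm

lemma ratio_eq_C {p q : ℝ[X]} (hp : p ≠ 0) {c : ℝ} (h : q = C c * p) :
    ratio q p = RatFunc.C c := by
  rw [ratio, div_eq_iff (RatFunc.algebraMap_ne_zero hp), h, map_mul, RatFunc.algebraMap_C]

theorem of_isTotallyNonneg_hurwitzMatrix {p q : ℝ[X]} (hp : 0 < p.leadingCoeff)
    (hq : q.degree ≤ p.degree) (h : IsTotallyNonneg (hurwitzMatrix p q)) :
    HasOnlyNonposZeros p ∧ (q = 0 ∨ HasOnlyNonposZeros q) ∧ 0 ≤ q.coeff p.natDegree ∧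
      (IsRFunctionNegType (ratio q p) ∨ ∃ c : ℝ, ratio q p = RatFunc.C c) := by
  rw [isTotallyNonneg_hurwitzMatrix_iff hq] at h
  have hp0 : p ≠ 0 := by rintro rfl; simp at hp
  have hqn := natDegree_le_natDegree hq
  set n := p.natDegree with hn
  have hTq : IsTotallyNonneg (toeplitz (reflect n q)) := by
    convert h.submatrix (u := fun i => 2 * i) (fun a b hab => by simpa using hab) strictMono_id
      using 1
    ext i j
    rw [Matrix.submatrix_apply, interlaced_even]; rfl
  have hTp : IsTotallyNonneg (toeplitz (reflect n p)) := by
    convert h.submatrix (u := fun i => 2 * i + 1) (v := fun j => j + 1)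
      (fun a b hab => by simpa using hab) (fun _ _ hab => Nat.succ_lt_succ hab) using 1
    ext i j
    rw [Matrix.submatrix_apply, interlaced_odd, toeplitz_X_mul, toeplitz_succ_succ]
  have hzp := hasOnlyNonposZeros_of_isTotallyNonneg_toeplitz hp0 le_rfl hTp
  refine ⟨hzp, or_iff_not_imp_left.2 fun hq0 =>
    hasOnlyNonposZeros_of_isTotallyNonneg_toeplitz hq0 hqn hTq, ?_, ?_⟩
  · have := hTq.entry_nonneg 0 (0 + 0)
    rwa [toeplitz_add, coeff_zero_reflect] at this
  have hA0 : 0 < (reflect n p).coeff 0 := by rw [coeff_zero_reflect]; exact hp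
  have hA : reflect n p ≠ 0 := by simpa using hp0
  rcases (im_pos_of_hasNonnegConsecutiveMinors
    (2 * ((reflect n q).natDegree + (reflect n p).natDegree + 1)) (reflect n q) (reflect n p)
    (fun i hi => coeff_eq_zero_of_natDegree_lt (by omega))
    (fun i hi => coeff_eq_zero_of_natDegree_lt (by omega)) hA0 h.hasNonnegConsecutiveMinors
    fun z hz _ h0 => hz.ne' (im_eq_zero_of_isTotallyNonneg_toeplitz hA hTp h0)).1 with ⟨c, hc⟩ | him
  · refine Or.inr ⟨c, ratio_eq_C hp0 ?_⟩
    ext i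
    have := congrArg (fun f => f.coeff (revAt n i)) hc
    simpa [coeff_reflect] using this
  · refine Or.inl fun z hz => ?_
    have hz0 : z ≠ 0 := by rintro rfl; simp at hz
    have hpz : aeval z p ≠ 0 := fun h0 => hz.ne' (hzp z h0).1
    have hq' := aeval_reflect_mul_pow hqn hz0
    have hp' := aeval_reflect_mul_pow (le_refl n) hz0
    have hpz' : aeval z⁻¹ (reflect n p) ≠ 0 := fun h0 => hpz (by rw [← hp', h0, zero_mul])
    rw [eval_ratio hpz, ← hq', ← hp', mul_div_mul_right _ _ (pow_ne_zero _ hz0)]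
    -- Reversal replaces z by 1/z in the lower half-plane; its conjugate returns to the upper one,
    -- which explains the change of sign.
    have h1 := him (starRingEnd ℂ z⁻¹) (by
      rw [Complex.conj_im, Complex.inv_im, ← neg_div, neg_neg]
      exact div_pos hz (Complex.normSq_pos.2 hz0))
    rw [aeval_conj, aeval_conj, Complex.conj_conj] at h1
    rw [div_eq_mul_inv, Complex.inv_def (aeval z⁻¹ (reflect n p)), ← mul_assoc, mul_comm,
      Complex.im_ofReal_mul]
    refine mul_neg_of_pos_of_neg (inv_pos.2 (Complex.normSq_pos.2 hpz')) ?_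
    rw [← neg_pos, ← Complex.conj_im, map_mul, Complex.conj_conj]
    exact h1

end

theorem mainTheorem1 (p q : ℝ[X]) (hp : 0 < p.leadingCoeff) (hq : q.degree ≤ p.degree) :
    (HasOnlyNonposZeros p ∧ (q = 0 ∨ HasOnlyNonposZeros q) ∧
        0 ≤ q.coeff p.natDegree ∧
        (IsRFunctionNegType (ratio q p) ∨ ∃ c : ℝ, ratio q p = RatFunc.C c)) ↔
      IsTotallyNonneg (hurwitzMatrix p q) :=
  ⟨fun ⟨hz, _, hq0, hR⟩ => isTotallyNonneg_hurwitzMatrix hp hq hz hq0 hR,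
    of_isTotallyNonneg_hurwitzMatrix hp hq⟩
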